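/- Let $f$ be analytic in the open right half-plane $\{\Re z>0\}$ and continuous on $\{\Re z\ge 0,\ z\neq 0\}$. Suppose that there are constants $\mathcal K,\sigma\in\mathbb R$ such that $|f(z)|\le \mathcal K|z|^{\sigma}$ for all sufficiently large $z$ with $\Re z>0$, and that there is a constant $\mathcal M$ such that $|f(z)|\le\mathcal M$ for all $z$ with $\Re z>0$ sufficiently close to $0$. Let $\omega>0$. All integrals over $(0,\infty)$ below are understood as Abel limits, that is, $$\int_0^\infty g(x)\,dx:=\lim_{s\to0^+}\int_0^\infty g(x)e^{-sx}\,dx .$$ Then all the Abel limits below exist (the integrals with the factor $e^{-sx}$ being absolutely convergent for every $s>0$), and the following holds. (1) For every $\mu\in\mathbb C$ with $\Re\mu>-1$, $$\int_0^\infty f(x)x^\mu e^{i\omega x}\,dx=e^{(\mu+1)\pi i/2}\int_0^\infty f(ix)x^\mu e^{-\omega x}\,dx .$$ (2) For all $\mu,\nu\in\mathbb C$ with $\Re(\mu+\nu)>-1$ and $\Re(\mu-\nu)>-1$, $$\int_0^\infty f(x)x^\mu J_\nu(\omega x)\,dx=\int_0^\infty \widehat f(ix)x^\mu K_\nu(\omega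 x)\,dx,\qquad \widehat f(z)=\frac{e^{(\mu-\nu)\pi i/2}f(z)+e^{(\nu-\mu)\pi i/2}f(-z)}{\pi},$$ where $J_\nu$ is the Bessel function of the first kind and $K_\nu$ is the modified Bessel function of the second kind. -/

import Mathlib

open Filter Topology MeasureTheory Set

/-- The Bessel function of the first kind
`J_ν(z) = (z/2)^ν ∑ₖ (-1)^k (z/2)^(2k) / (k! Γ(ν+k+1))` (principal branch of the power).
Mathlib's `Complex.Gamma` is `0` at its poles, so `(Gamma ·)⁻¹` is the entire function `1/Γ`. -/
noncomputable def besselJ (ν z : ℂ) : ℂ :=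
  (z / 2) ^ ν * ∑' k : ℕ,
    (-1) ^ k * (z / 2) ^ (2 * k) * ((k.factorial : ℂ) * Complex.Gamma (ν + k + 1))⁻¹

/-- The modified Bessel function of the first kind
`I_ν(z) = (z/2)^ν ∑ₖ (z/2)^(2k) / (k! Γ(ν+k+1))` (principal branch of the power). -/
noncomputable def besselI (ν z : ℂ) : ℂ :=
  (z / 2) ^ ν * ∑' k : ℕ,
    (z / 2) ^ (2 * k) * ((k.factorial : ℂ) * Complex.Gamma (ν + k + 1))⁻¹

/-- The modified Bessel function of the second kind (Macdonald function),
`K_ν(z) = (π/2) (I_{-ν}(z) - I_ν(z)) / sin(νπ)`; if the order `ν` is an integer, it is the limit of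
the right-hand side as the order tends to `ν`. The limit exists for all `z ≠ 0`, because
`I_a(z)` is entire in `a`, `I_{-n}(z) = I_n(z)` for integers `n`, and `sin(aπ)` has simple zeros. -/
noncomputable def besselK (ν z : ℂ) : ℂ :=
  open Classical in
  if ∃ n : ℤ, ν = n then
    limUnder (𝓝[≠] ν) fun a : ℂ =>
      (Real.pi / 2 : ℂ) * (besselI (-a) z - besselI a z) / Complex.sin (a * Real.pi)
  else
    (Real.pi / 2 : ℂ) * (besselI (-ν) z - besselI ν z) / Complex.sin (ν * Real.pi)

/-- `HasAbelIntegral g L`: the improper integral `∫₀^∞ g(x) dx` exists as an Abel limit and equals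
`L`, i.e. `∫₀^∞ g(x) e^{-sx} dx` converges (absolutely) for every `s > 0` and tends to `L` as
`s → 0⁺`. -/
def HasAbelIntegral (g : ℝ → ℂ) (L : ℂ) : Prop :=
  (∀ s : ℝ, 0 < s → IntegrableOn (fun x : ℝ => g x * Complex.exp (-(s * x))) (Ioi 0)) ∧
    Tendsto (fun s : ℝ => ∫ x in Ioi (0 : ℝ), g x * Complex.exp (-(s * x))) (𝓝[>] 0) (𝓝 L)

/-- `f̂(z) = (e^{(μ-ν)πi/2} f(z) + e^{(ν-μ)πi/2} f(-z)) / π`. -/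
noncomputable def rotHat (μ ν : ℂ) (f : ℂ → ℂ) (z : ℂ) : ℂ :=
  (Complex.exp ((μ - ν) * Real.pi * Complex.I / 2) * f z +
    Complex.exp ((ν - μ) * Real.pi * Complex.I / 2) * f (-z)) / Real.pi

/-!
Both identities come from rotating the path of integration from the positive real axis to the
imaginary axis. If `k` is analytic in a quadrant, grows polynomially, and carries a factor that
decays exponentially in `|Im z|`, then for every `s > 0` the factor `e^{-sz}` supplies the missing
decay in `Re z`, so Cauchy's theorem applies (`integral_Ioi_eq_I_mul_integral`); on the imaginary
axis `|e^{-sz}| = 1`, and dominated convergence lets `s` tend to `0`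
(`hasAbelIntegral_of_firstQuadrant`, `hasAbelIntegral_of_fourthQuadrant`).

The first identity is the case `k(z) = f(z) z^μ e^{iωz}`. For the second, the connection formula
`πi J_ν(x) = e^{-νπi/2} K_ν(-ix) - e^{νπi/2} K_ν(ix)` (`pi_mul_I_mul_besselJ`) splits the integrand
into a part that rotates through the first quadrant and a part that rotates through the fourth.

This needs `K_ν` to be analytic in the right half-plane, to be `O(|w|^{-a})` at `0` for every
`a > |Re ν|`, and to decay exponentially in `Re w`, all of it up to the imaginary axis, where the
usual integral `∫ exp (-w cosh t) cosh (ν t) dt` is no longer absolutely convergent. Contours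
whose ends are tilted by an angle `β` take its place. Hankel's formula for `1/Γ` is proved on
tilted contours (`cpow_mul_hankelIntegral`): the contour integral times `w ^ p` is constant in `w`,
satisfies the recursion of `1/Γ` in `p`, and is evaluated for `Re p > 0` by letting `w` tend to `0`.
Inserting it into the power series of `I_ν` gives Schläfli's integral (`besselI_eq`), and the
definition of `K_ν` through `I_{±ν}` then gives an integral for `K_ν` (`besselK_eq`) that converges
absolutely for `Re (w e^{-iβ}) > 0` and is continuous in the order, which covers integer orders. The
choices `β = ±π/4` together reach the closed right half-plane without `0`.
-/

/-! ### Exponential integrals along rays and arcs -/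

/-- `∫ r > 0, exp (-w c(r)) exp (p (r - iβ))`: an integral along the horizontal ray
`v = r - iβ` with weight `exp (p v)`; it is used with `c = exp v` and `c = cosh v`. -/
noncomputable def rayIntegral (c : ℝ → ℂ) (β : ℝ) (p w : ℂ) : ℂ :=
  ∫ r in Ioi (0 : ℝ), Complex.exp (-(w * c r)) * Complex.exp (p * (r - β * Complex.I))

/-- `∫_a^b exp (w c(θ)) exp (i p θ) dθ`; it is used with `c = exp (iθ)` and `c = cos θ`. -/
noncomputable def arcIntegral (c : ℝ → ℂ) (a b : ℝ) (p w : ℂ) : ℂ :=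
  ∫ θ in a..b, Complex.exp (w * c θ) * Complex.exp (p * (θ * Complex.I))

/-- `c` is continuous and stays within distance `1` of `κ exp (r - iβ)` along the ray. -/
structure IsExpLike (c : ℝ → ℂ) (β κ : ℝ) : Prop where
  cont : Continuous c
  pos : 0 < κ
  near : ∀ r : ℝ, 0 < r → ‖c r - κ * Complex.exp (r - β * Complex.I)‖ ≤ 1

/-- The half-plane `Re (w e^{-iβ}) > 0`, the right half-plane turned by the angle `β`. -/
def tiltedHalfPlane (β : ℝ) : Set ℂ := {w : ℂ | 0 < (w * Complex.exp (-(β * Complex.I))).re}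

lemma isOpen_tiltedHalfPlane (β : ℝ) : IsOpen (tiltedHalfPlane β) :=
  isOpen_lt continuous_const (by fun_prop)

lemma convex_tiltedHalfPlane (β : ℝ) : Convex ℝ (tiltedHalfPlane β) := by
  have h : IsLinearMap ℝ (fun w : ℂ => (w * Complex.exp (-(β * Complex.I))).re) :=
    ⟨fun x y => by simp [add_mul], fun c x => by simp [mul_assoc, mul_sub]⟩
  exact convex_halfSpace_gt h 0

lemma exp_neg_ofReal_mul_I (β : ℝ) :
    Complex.exp (-(β * Complex.I)) = Real.cos β - Real.sin β * Complex.I := by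
  rw [← neg_mul, Complex.exp_mul_I]
  simp [sub_eq_add_neg]

lemma re_mul_exp_neg_mul_I (β : ℝ) (w : ℂ) :
    (w * Complex.exp (-(β * Complex.I))).re = w.re * Real.cos β + w.im * Real.sin β := by
  rw [exp_neg_ofReal_mul_I]
  simp [Complex.mul_re, Complex.cos_ofReal_re, Complex.sin_ofReal_re]

lemma mem_tiltedHalfPlane {β : ℝ} {w : ℂ} :
    w ∈ tiltedHalfPlane β ↔ 0 < w.re * Real.cos β + w.im * Real.sin β := by
  rw [← re_mul_exp_neg_mul_I]; rfl

lemma tiltedHalfPlane_subset_slitPlane {β : ℝ} (hβ : 0 < Real.cos β) :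
    tiltedHalfPlane β ⊆ Complex.slitPlane := by
  intro w hw
  rw [mem_tiltedHalfPlane] at hw
  rw [Complex.mem_slitPlane_iff]
  by_contra! h
  rw [h.2, zero_mul, add_zero] at hw
  nlinarith [h.1]

lemma div_two_mem_tiltedHalfPlane {β : ℝ} {w : ℂ} (hw : w ∈ tiltedHalfPlane β) :
    w / 2 ∈ tiltedHalfPlane β := by
  rw [mem_tiltedHalfPlane] at hw ⊢
  simp only [Complex.div_ofNat_re, Complex.div_ofNat_im]
  linarith

lemma exp_neg_le_rpow {a : ℝ} (ha : 0 < a) {x : ℝ} (hx : 0 < x) :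
    Real.exp (-x) ≤ a ^ a * x ^ (-a) := by
  have h1 : x / a ≤ Real.exp (x / a) := by linarith [Real.add_one_le_exp (x / a)]
  have h2 := Real.rpow_le_rpow (by positivity) h1 ha.le
  rw [Real.div_rpow hx.le ha.le, ← Real.exp_mul, div_mul_cancel₀ _ ha.ne',
    div_le_iff₀ (by positivity)] at h2
  rw [Real.exp_neg, Real.rpow_neg hx.le, ← div_eq_mul_inv, le_div_iff₀ (by positivity),
    inv_mul_le_iff₀ (Real.exp_pos _)]
  exact h2

/-- The double exponential beats every exponential, with the optimal power of the constant
`t`. -/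
lemma exp_neg_mul_exp_mul_exp_le {a : ℝ} (ha : 0 < a) (m : ℝ) {t : ℝ} (ht : 0 < t) (r : ℝ) :
    Real.exp (-(t * Real.exp r)) * Real.exp (m * r) ≤
      a ^ a * t ^ (-a) * Real.exp ((m - a) * r) := by
  have h := exp_neg_le_rpow ha (x := t * Real.exp r) (by positivity)
  rw [Real.mul_rpow ht.le (Real.exp_pos r).le, ← Real.exp_mul] at h
  calc _ ≤ a ^ a * (t ^ (-a) * Real.exp (r * -a)) * Real.exp (m * r) := by gcongr
    _ = _ := by
      rw [mul_assoc, mul_assoc, ← Real.exp_add, ← mul_assoc]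
      ring_nf

lemma integrableOn_exp_neg_mul_exp_mul_exp (m : ℝ) {t : ℝ} (ht : 0 < t) :
    IntegrableOn (fun r : ℝ => Real.exp (-(t * Real.exp r)) * Real.exp (m * r)) (Ioi 0) := by
  have ha : (0 : ℝ) < |m| + 1 := by positivity
  refine Integrable.mono' (g := fun r => (|m| + 1) ^ (|m| + 1) * t ^ (-(|m| + 1)) *
    Real.exp ((m - (|m| + 1)) * r)) ?_ (by fun_prop) (ae_of_all _ fun r => ?_)
  · exact (integrableOn_exp_mul_Ioi (by linarith [le_abs_self m]) 0).const_mul _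
  · rw [Real.norm_of_nonneg (by positivity)]
    exact exp_neg_mul_exp_mul_exp_le ha m ht r

lemma norm_exp_mul_sub_le (β : ℝ) (p : ℂ) {r : ℝ} (hr : 0 ≤ r) :
    ‖Complex.exp (p * (r - β * Complex.I))‖ ≤ Real.exp (‖p‖ * |β|) * Real.exp (‖p‖ * r) := by
  rw [Complex.norm_exp, ← Real.exp_add, Real.exp_le_exp]
  have h1 : (p * (r - β * Complex.I)).re = p.im * β + p.re * r := by
    simp [Complex.mul_re]; ring
  rw [h1]
  have h2 : p.im * β ≤ ‖p‖ * |β| := by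
    calc p.im * β ≤ |p.im * β| := le_abs_self _
      _ = |p.im| * |β| := abs_mul _ _
      _ ≤ _ := by gcongr; exact Complex.abs_im_le_norm p
  have h3 : p.re * r ≤ ‖p‖ * r := by
    gcongr; exact Complex.re_le_norm p
  linarith

namespace IsExpLike

variable {c : ℝ → ℂ} {β κ : ℝ}

lemma norm_le (h : IsExpLike c β κ) {r : ℝ} (hr : 0 < r) :
    ‖c r‖ ≤ (κ + 1) * Real.exp r := by
  have h1 := h.near r hr
  have h2 : ‖(κ : ℂ) * Complex.exp (r - β * Complex.I)‖ = κ * Real.exp r := by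
    rw [norm_mul, Complex.norm_exp]; simp [h.pos.le]
  have h3 := norm_sub_norm_le (c r) (κ * Complex.exp (r - β * Complex.I))
  have h4 : 1 ≤ Real.exp r := Real.one_le_exp hr.le
  linarith

lemma norm_exp_le (h : IsExpLike c β κ) {r : ℝ} (hr : 0 < r) {w : ℂ} {ε M : ℝ}
    (hε : ε ≤ (w * Complex.exp (-(β * Complex.I))).re) (hM : ‖w‖ ≤ M) :
    ‖Complex.exp (-(w * c r))‖ ≤ Real.exp M * Real.exp (-(κ * ε * Real.exp r)) := by
  rw [Complex.norm_exp, ← Real.exp_add, Real.exp_le_exp]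
  have h1 : -(w * c r) = -(w * (c r - κ * Complex.exp (r - β * Complex.I))) -
      (κ * Real.exp r : ℝ) * (w * Complex.exp (-(β * Complex.I))) := by
    rw [sub_eq_add_neg (r : ℂ), Complex.exp_add]; push_cast; ring
  rw [h1, Complex.sub_re, Complex.re_ofReal_mul]
  have h2 : (-(w * (c r - κ * Complex.exp (r - β * Complex.I)))).re ≤ M := by
    calc _ ≤ ‖-(w * (c r - κ * Complex.exp (r - β * Complex.I)))‖ := Complex.re_le_norm _
      _ ≤ M * 1 := by
        rw [norm_neg, norm_mul]
        exact mul_le_mul hM (h.near r hr) (norm_nonneg _) ((norm_nonneg _).trans hM)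
      _ = M := mul_one M
  have h3 : κ * Real.exp r * ε ≤
      κ * Real.exp r * (w * Complex.exp (-(β * Complex.I))).re :=
    mul_le_mul_of_nonneg_left hε (mul_pos h.pos (Real.exp_pos r)).le
  nlinarith

lemma norm_integrand_le (h : IsExpLike c β κ) {r : ℝ} (hr : 0 < r) {w p : ℂ} {ε M P : ℝ}
    (hε : ε ≤ (w * Complex.exp (-(β * Complex.I))).re) (hM : ‖w‖ ≤ M) (hP : ‖p‖ ≤ P) :
    ‖Complex.exp (-(w * c r)) * Complex.exp (p * (r - β * Complex.I))‖ ≤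
      Real.exp M * Real.exp (P * |β|) *
        (Real.exp (-(κ * ε * Real.exp r)) * Real.exp (P * r)) := by
  rw [norm_mul]
  calc _ ≤ (Real.exp M * Real.exp (-(κ * ε * Real.exp r))) *
        (Real.exp (‖p‖ * |β|) * Real.exp (‖p‖ * r)) :=
        mul_le_mul (h.norm_exp_le hr hε hM) (norm_exp_mul_sub_le β p hr.le) (norm_nonneg _)
          (by positivity)
    _ ≤ (Real.exp M * Real.exp (-(κ * ε * Real.exp r))) *
        (Real.exp (P * |β|) * Real.exp (P * r)) := by gcongr
    _ = _ := by ring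

lemma continuous_integrand (h : IsExpLike c β κ) (p w : ℂ) :
    Continuous fun r : ℝ =>
      Complex.exp (-(w * c r)) * Complex.exp (p * (r - β * Complex.I)) := by
  have := h.cont
  fun_prop

lemma integrableOn (h : IsExpLike c β κ) (p : ℂ) {w : ℂ} (hw : w ∈ tiltedHalfPlane β) :
    IntegrableOn (fun r : ℝ => Complex.exp (-(w * c r)) *
      Complex.exp (p * (r - β * Complex.I))) (Ioi 0) := by
  refine Integrable.mono' (((integrableOn_exp_neg_mul_exp_mul_exp ‖p‖
    (mul_pos h.pos hw)).const_mul (Real.exp ‖w‖ * Real.exp (‖p‖ * |β|))))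
    (h.continuous_integrand p w).aestronglyMeasurable ?_
  filter_upwards [ae_restrict_mem measurableSet_Ioi] with r hr
  exact h.norm_integrand_le hr le_rfl le_rfl le_rfl

lemma hasDerivAt_rayIntegral (h : IsExpLike c β κ) (p : ℂ) {w : ℂ}
    (hw : w ∈ tiltedHalfPlane β) :
    HasDerivAt (rayIntegral c β p)
      (∫ r in Ioi (0 : ℝ), -c r * (Complex.exp (-(w * c r)) *
        Complex.exp (p * (r - β * Complex.I)))) w := by
  have hc := h.cont
  have hκ := h.pos
  set ε := (w * Complex.exp (-(β * Complex.I))).re / 2 with hε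
  have hw' : 0 < (w * Complex.exp (-(β * Complex.I))).re := hw
  have hεpos : 0 < ε := by positivity
  have hs : {z : ℂ | ε < (z * Complex.exp (-(β * Complex.I))).re} ∩ {z | ‖z‖ < ‖w‖ + 1} ∈ 𝓝 w := by
    refine IsOpen.mem_nhds ((isOpen_lt continuous_const (by fun_prop)).inter
      (isOpen_lt (by fun_prop) continuous_const)) ⟨?_, ?_⟩
    · show ε < (w * Complex.exp (-(β * Complex.I))).re
      linarith
    · simp
  refine (hasDerivAt_integral_of_dominated_loc_of_deriv_le
    (bound := fun r => (κ + 1) * (Real.exp (‖w‖ + 1) * Real.exp (‖p‖ * |β|)) *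
      (Real.exp (-(κ * ε * Real.exp r)) * Real.exp ((‖p‖ + 1) * r)))
    (F := fun w r => Complex.exp (-(w * c r)) * Complex.exp (p * (r - β * Complex.I)))
    (F' := fun w r => -c r * (Complex.exp (-(w * c r)) * Complex.exp (p * (r - β * Complex.I))))
    hs ?_ (h.integrableOn p hw) ?_ ?_ ?_ ?_).2
  · exact Eventually.of_forall fun z => (h.continuous_integrand p z).aestronglyMeasurable
  · exact (hc.neg.mul (h.continuous_integrand p w)).aestronglyMeasurable
  · filter_upwards [ae_restrict_mem measurableSet_Ioi] with r hr z hz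
    rw [norm_mul, norm_neg]
    calc _ ≤ ((κ + 1) * Real.exp r) * (Real.exp (‖w‖ + 1) * Real.exp (‖p‖ * |β|) *
        (Real.exp (-(κ * ε * Real.exp r)) * Real.exp (‖p‖ * r))) :=
          mul_le_mul (h.norm_le hr) (h.norm_integrand_le hr hz.1.le hz.2.le le_rfl)
            (norm_nonneg _) (by positivity)
      _ = _ := by rw [add_mul ‖p‖, Real.exp_add (‖p‖ * r), one_mul]; ring
  · exact (integrableOn_exp_neg_mul_exp_mul_exp _ (mul_pos hκ hεpos)).const_mul _
  · refine ae_of_all _ fun r z _ => ?_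
    have h1 : HasDerivAt (fun z : ℂ => -(z * c r)) (-(1 * c r)) z :=
      ((hasDerivAt_id z).mul_const (c r)).neg
    exact (h1.cexp.mul_const (Complex.exp (p * (r - β * Complex.I)))).congr_deriv (by ring)

lemma continuous_rayIntegral (h : IsExpLike c β κ) {w : ℂ} (hw : w ∈ tiltedHalfPlane β) :
    Continuous fun p => rayIntegral c β p w := by
  have hc := h.cont
  refine continuous_iff_continuousAt.2 fun p => ?_
  refine continuousAt_of_dominated (bound := fun r =>
    Real.exp ‖w‖ * Real.exp ((‖p‖ + 1) * |β|) *
      (Real.exp (-(κ * (w * Complex.exp (-(β * Complex.I))).re * Real.exp r)) *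
        Real.exp ((‖p‖ + 1) * r))) ?_ ?_ ?_ ?_
  · exact Eventually.of_forall fun q => (h.continuous_integrand q w).aestronglyMeasurable
  · have : ∀ᶠ q : ℂ in 𝓝 p, ‖q‖ < ‖p‖ + 1 :=
      (isOpen_lt continuous_norm continuous_const).mem_nhds (by simp)
    filter_upwards [this] with q hq
    filter_upwards [ae_restrict_mem measurableSet_Ioi] with r hr
    exact h.norm_integrand_le hr le_rfl le_rfl hq.le
  · exact (integrableOn_exp_neg_mul_exp_mul_exp _ (mul_pos h.pos hw)).const_mul _
  · exact ae_of_all _ fun r => by fun_prop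

end IsExpLike

lemma hasDerivAt_arcIntegral {c : ℝ → ℂ} (hc : Continuous c) (hc1 : ∀ θ, ‖c θ‖ ≤ 1) (a b : ℝ)
    (p w : ℂ) :
    HasDerivAt (arcIntegral c a b p)
      (∫ θ in a..b, c θ * (Complex.exp (w * c θ) * Complex.exp (p * (θ * Complex.I)))) w := by
  refine (intervalIntegral.hasDerivAt_integral_of_dominated_loc_of_deriv_le
    (bound := fun θ => Real.exp (‖w‖ + 1) * ‖Complex.exp (p * (θ * Complex.I))‖)
    (F := fun w θ => Complex.exp (w * c θ) * Complex.exp (p * (θ * Complex.I)))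
    (F' := fun w θ => c θ * (Complex.exp (w * c θ) * Complex.exp (p * (θ * Complex.I))))
    (s := {z : ℂ | ‖z‖ < ‖w‖ + 1})
    ((isOpen_lt continuous_norm continuous_const).mem_nhds
      (show ‖w‖ < ‖w‖ + 1 by simp)) ?_ ?_ ?_ ?_ ?_ ?_).2
  · exact Eventually.of_forall fun z => Continuous.aestronglyMeasurable (by fun_prop)
  · exact Continuous.intervalIntegrable (by fun_prop) _ _
  · exact Continuous.aestronglyMeasurable (by fun_prop)
  · refine ae_of_all _ fun θ _ z hz => ?_
    rw [norm_mul, norm_mul, ← mul_assoc]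
    gcongr
    have h1 : ‖Complex.exp (z * c θ)‖ ≤ Real.exp (‖w‖ + 1) := by
      refine (Complex.norm_exp_le_exp_norm _).trans (Real.exp_le_exp.2 ?_)
      rw [norm_mul]
      nlinarith [hc1 θ, norm_nonneg z, norm_nonneg (c θ), show ‖z‖ < ‖w‖ + 1 from hz]
    nlinarith [hc1 θ, norm_nonneg (c θ), norm_nonneg (Complex.exp (z * c θ))]
  · exact Continuous.intervalIntegrable (by fun_prop) _ _
  · refine ae_of_all _ fun θ _ z _ => ?_
    have h1 : HasDerivAt (fun z : ℂ => z * c θ) (1 * c θ) z :=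
      (hasDerivAt_id z).mul_const (c θ)
    exact (h1.cexp.mul_const (Complex.exp (p * (θ * Complex.I)))).congr_deriv (by ring)

lemma continuous_arcIntegral {c : ℝ → ℂ} (hc : Continuous c) (a b : ℝ) (w : ℂ) :
    Continuous fun p => arcIntegral c a b p w :=
  intervalIntegral.continuous_parametric_intervalIntegral_of_continuous' (by fun_prop) a b

/-- Termwise integration of the exponential series. -/
lemma hasSum_integral_exp_mul {α : Type*} [MeasurableSpace α] {μ : Measure α} {G q : α → ℂ}
    (hG : Integrable G μ) (hq : AEStronglyMeasurable q μ) (hq1 : ∀ᵐ a ∂μ, ‖q a‖ ≤ 1) (x : ℂ) :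
    HasSum (fun k : ℕ => x ^ k / k.factorial * ∫ a, q a ^ k * G a ∂μ)
      (∫ a, Complex.exp (x * q a) * G a ∂μ) := by
  simp_rw [← integral_const_mul]
  have hsum : Summable fun k : ℕ => ‖x‖ ^ k / k.factorial := Real.summable_pow_div_factorial ‖x‖
  refine hasSum_integral_of_dominated_convergence
    (fun (k : ℕ) a => ‖x‖ ^ k / k.factorial * ‖G a‖) ?_ ?_ ?_ ?_ ?_
  · exact fun k => ((hq.pow k).mul hG.aestronglyMeasurable).const_mul _
  · intro k
    filter_upwards [hq1] with a ha
    simp only [norm_mul, norm_div, norm_pow, Complex.norm_natCast]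
    gcongr
    exact mul_le_of_le_one_left (norm_nonneg _) (pow_le_one₀ (norm_nonneg _) ha)
  · exact ae_of_all _ fun a => hsum.mul_right _
  · simp_rw [tsum_mul_right]
    exact hG.norm.const_mul _
  · refine ae_of_all _ fun a => ?_
    have h := (NormedSpace.expSeries_div_hasSum_exp (𝔸 := ℂ) (x * q a)).mul_right (G a)
    rw [← Complex.exp_eq_exp_ℂ] at h
    have e : (fun k : ℕ => x ^ k / k.factorial * (q a ^ k * G a)) =
        fun k : ℕ => (x * q a) ^ k / k.factorial * G a := by
      funext k; rw [mul_pow]; ring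
    rw [e]
    exact h

/-! ### Hankel's integral for the reciprocal Gamma function -/

lemma isExpLike_exp (β : ℝ) :
    IsExpLike (fun r : ℝ => Complex.exp (r - β * Complex.I)) β 1 where
  cont := by fun_prop
  pos := one_pos
  near r _ := by simp

lemma IsExpLike.tendsto_integrand {c : ℝ → ℂ} {β κ : ℝ} (h : IsExpLike c β κ) (p : ℂ) {w : ℂ}
    (hw : w ∈ tiltedHalfPlane β) :
    Tendsto (fun r : ℝ => Complex.exp (-(w * c r)) * Complex.exp (p * (r - β * Complex.I)))
      atTop (𝓝 0) := by
  set t := κ * (w * Complex.exp (-(β * Complex.I))).re with ht_def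
  have ht : 0 < t := mul_pos h.pos hw
  set a := ‖p‖ + 1 with ha_def
  have ha : 0 < a := by positivity
  refine squeeze_zero_norm' (a := fun r => Real.exp ‖w‖ * Real.exp (‖p‖ * |β|) *
    (a ^ a * t ^ (-a) * Real.exp (-r))) ?_ ?_
  · filter_upwards [eventually_gt_atTop 0] with r hr
    refine (h.norm_integrand_le hr le_rfl le_rfl le_rfl).trans ?_
    refine mul_le_mul_of_nonneg_left ?_ (by positivity)
    have := exp_neg_mul_exp_mul_exp_le ha ‖p‖ ht r
    rwa [show (‖p‖ - a) * r = -r by rw [ha_def]; ring] at this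
  · have := (Real.tendsto_exp_neg_atTop_nhds_zero.const_mul
      (a ^ a * t ^ (-a))).const_mul (Real.exp ‖w‖ * Real.exp (‖p‖ * |β|))
    simpa using this

lemma hasDerivAt_rayIntegral_exp (β : ℝ) (p : ℂ) {w : ℂ} (hw : w ∈ tiltedHalfPlane β) :
    HasDerivAt (rayIntegral (fun r : ℝ => Complex.exp (r - β * Complex.I)) β p)
      (-rayIntegral (fun r : ℝ => Complex.exp (r - β * Complex.I)) β (p + 1) w) w := by
  refine ((isExpLike_exp β).hasDerivAt_rayIntegral p hw).congr_deriv ?_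
  rw [rayIntegral, ← integral_neg]
  congr 1 with r
  rw [add_mul p, Complex.exp_add, one_mul]
  ring

lemma hasDerivAt_arcIntegral_exp (a b : ℝ) (p w : ℂ) :
    HasDerivAt (arcIntegral (fun θ : ℝ => Complex.exp (θ * Complex.I)) a b p)
      (arcIntegral (fun θ : ℝ => Complex.exp (θ * Complex.I)) a b (p + 1) w) w := by
  refine (hasDerivAt_arcIntegral (by fun_prop)
    (fun θ => (Complex.norm_exp_ofReal_mul_I θ).le) a b p w).congr_deriv ?_
  rw [arcIntegral]
  congr 1 with θ
  rw [add_mul p, Complex.exp_add, one_mul]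
  ring

/-- Integration by parts along the ray. -/
lemma rayIntegral_exp_recurrence (β : ℝ) (p : ℂ) {w : ℂ} (hw : w ∈ tiltedHalfPlane β) :
    p * rayIntegral (fun r : ℝ => Complex.exp (r - β * Complex.I)) β p w -
      w * rayIntegral (fun r : ℝ => Complex.exp (r - β * Complex.I)) β (p + 1) w =
    -(Complex.exp (-(w * Complex.exp (-(β * Complex.I)))) *
      Complex.exp (p * (-(β * Complex.I)))) := by
  have h := isExpLike_exp β
  have hint := (h.integrableOn p hw).const_mul p |>.sub ((h.integrableOn (p + 1) hw).const_mul w)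
  have key := integral_Ioi_of_hasDerivAt_of_tendsto' (a := 0) (fun r _ => ?_) hint
    (h.tendsto_integrand p hw)
  · simp only [Pi.sub_apply] at key
    rw [integral_sub ((h.integrableOn p hw).const_mul p)
      ((h.integrableOn (p + 1) hw).const_mul w), integral_const_mul, integral_const_mul] at key
    simpa [rayIntegral] using key
  · have h1 : HasDerivAt (fun r : ℝ => (r : ℂ) - β * Complex.I) 1 r :=
      Complex.ofRealCLM.hasDerivAt.sub_const _
    have h2 := ((h1.cexp.const_mul w).neg.cexp).mul ((h1.const_mul p).cexp)
    refine h2.congr_deriv ?_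
    simp only [Pi.sub_apply, Pi.neg_apply]
    rw [add_mul p, Complex.exp_add, one_mul]
    ring

/-- Integration by parts along the arc. -/
lemma arcIntegral_exp_recurrence (a b : ℝ) (p w : ℂ) :
    Complex.I * (p * arcIntegral (fun θ : ℝ => Complex.exp (θ * Complex.I)) a b p w +
      w * arcIntegral (fun θ : ℝ => Complex.exp (θ * Complex.I)) a b (p + 1) w) =
    Complex.exp (w * Complex.exp (b * Complex.I)) * Complex.exp (p * (b * Complex.I)) -
      Complex.exp (w * Complex.exp (a * Complex.I)) * Complex.exp (p * (a * Complex.I)) := by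
  have hi : ∀ q : ℂ, IntervalIntegrable (fun θ : ℝ => Complex.exp (w * Complex.exp (θ * Complex.I)) *
      Complex.exp (q * (θ * Complex.I))) volume a b :=
    fun q => Continuous.intervalIntegrable (by fun_prop) _ _
  have hint := ((hi p).const_mul p).add ((hi (p + 1)).const_mul w) |>.const_mul Complex.I
  have key := intervalIntegral.integral_eq_sub_of_hasDerivAt
    (f' := fun θ : ℝ => Complex.I * (p * (Complex.exp (w * Complex.exp (θ * Complex.I)) *
      Complex.exp (p * (θ * Complex.I))) + w * (Complex.exp (w * Complex.exp (θ * Complex.I)) *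
      Complex.exp ((p + 1) * (θ * Complex.I)))))
    (f := fun θ : ℝ => Complex.exp (w * Complex.exp (θ * Complex.I)) *
      Complex.exp (p * (θ * Complex.I))) (fun θ _ => ?_) hint
  · rw [← key, intervalIntegral.integral_const_mul, intervalIntegral.integral_add
      ((hi p).const_mul p) ((hi (p + 1)).const_mul w), intervalIntegral.integral_const_mul,
      intervalIntegral.integral_const_mul]
    rfl
  · have h1 : HasDerivAt (fun θ : ℝ => (θ : ℂ) * Complex.I) (1 * Complex.I) θ :=
      Complex.ofRealCLM.hasDerivAt.mul_const _
    have h2 := ((h1.cexp.const_mul w).cexp).mul ((h1.const_mul p).cexp)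
    refine h2.congr_deriv ?_
    rw [add_mul p, Complex.exp_add, one_mul]
    ring_nf

/-- Hankel's integral `(1 / 2πi) ∫ exp (w eᵘ) exp (p u) du` over the contour that comes from
`+∞ - i(π + β)`, passes along the segment `[-i(π + β), i(π - β)]` and returns to
`+∞ + i(π - β)`; the two rays are combined into one by periodicity. -/
noncomputable def hankelIntegral (β : ℝ) (p w : ℂ) : ℂ :=
  Complex.sin (Real.pi * p) / Real.pi *
      rayIntegral (fun r : ℝ => Complex.exp (r - β * Complex.I)) β p w +
    1 / (2 * Real.pi) * arcIntegral (fun θ : ℝ => Complex.exp (θ * Complex.I))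
      (-Real.pi - β) (Real.pi - β) p w

lemma sin_pi_mul_add_one (p : ℂ) :
    Complex.sin (Real.pi * (p + 1)) = -Complex.sin (Real.pi * p) := by
  rw [mul_add, mul_one, Complex.sin_add_pi]

lemma hasDerivAt_hankelIntegral (β : ℝ) (p : ℂ) {w : ℂ} (hw : w ∈ tiltedHalfPlane β) :
    HasDerivAt (hankelIntegral β p) (hankelIntegral β (p + 1) w) w := by
  refine (((hasDerivAt_rayIntegral_exp β p hw).const_mul _).add
    ((hasDerivAt_arcIntegral_exp _ _ p w).const_mul _)).congr_deriv ?_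
  rw [hankelIntegral, sin_pi_mul_add_one]
  ring

lemma hankelIntegral_recurrence (β : ℝ) (p : ℂ) {w : ℂ} (hw : w ∈ tiltedHalfPlane β) :
    w * hankelIntegral β (p + 1) w = -p * hankelIntegral β p w := by
  have h1 := rayIntegral_exp_recurrence β p hw
  have h2 := arcIntegral_exp_recurrence (-Real.pi - β) (Real.pi - β) p w
  have e1 : Complex.exp (((Real.pi - β : ℝ) : ℂ) * Complex.I) =
      -Complex.exp (-(β * Complex.I)) := by
    push_cast
    rw [sub_mul, sub_eq_add_neg, Complex.exp_add, Complex.exp_pi_mul_I]; ring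
  have e2 : Complex.exp (((-Real.pi - β : ℝ) : ℂ) * Complex.I) =
      -Complex.exp (-(β * Complex.I)) := by
    push_cast
    rw [sub_mul, sub_eq_add_neg, Complex.exp_add, neg_mul, Complex.exp_neg,
      Complex.exp_pi_mul_I]
    norm_num
  have e3 : Complex.exp (p * (((Real.pi - β : ℝ) : ℂ) * Complex.I)) =
      Complex.exp (p * (-(β * Complex.I))) * Complex.exp (Real.pi * p * Complex.I) := by
    rw [← Complex.exp_add]; push_cast; ring_nf
  have e4 : Complex.exp (p * (((-Real.pi - β : ℝ) : ℂ) * Complex.I)) =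
      Complex.exp (p * (-(β * Complex.I))) * Complex.exp (-(Real.pi * p) * Complex.I) := by
    rw [← Complex.exp_add]; push_cast; ring_nf
  rw [e1, e2, e3, e4, mul_neg] at h2
  have hs := Complex.two_sin (Real.pi * p)
  have hpi : (Real.pi : ℂ) ≠ 0 := by exact_mod_cast Real.pi_ne_zero
  have h3 : p * arcIntegral (fun θ : ℝ => Complex.exp (θ * Complex.I))
      (-Real.pi - β) (Real.pi - β) p w + w * arcIntegral (fun θ : ℝ => Complex.exp (θ * Complex.I))
      (-Real.pi - β) (Real.pi - β) (p + 1) w =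
      2 * Complex.sin (Real.pi * p) * (Complex.exp (-(w * Complex.exp (-(β * Complex.I)))) *
      Complex.exp (p * (-(β * Complex.I)))) := by
    rw [hs]
    linear_combination (-Complex.I) * h2 + (p * arcIntegral (fun θ : ℝ =>
      Complex.exp (θ * Complex.I)) (-Real.pi - β) (Real.pi - β) p w + w * arcIntegral
      (fun θ : ℝ => Complex.exp (θ * Complex.I)) (-Real.pi - β) (Real.pi - β) (p + 1) w) *
        Complex.I_mul_I
  rw [hankelIntegral, hankelIntegral, sin_pi_mul_add_one]
  generalize arcIntegral _ _ _ (p + 1) w = A1 at h3 ⊢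
  generalize arcIntegral _ _ _ p w = A0 at h3 ⊢
  generalize rayIntegral _ _ (p + 1) w = R1 at h1 ⊢
  generalize rayIntegral _ _ p w = R0 at h1 ⊢
  field_simp
  linear_combination 2 * Complex.sin (Real.pi * p) * h1 + h3

/-- The quantity `w ^ p * hankelIntegral β p w` does not depend on `w`. -/
lemma cpow_mul_hankelIntegral_eq {β : ℝ} (hβ : 0 < Real.cos β) (p : ℂ) {w z : ℂ}
    (hw : w ∈ tiltedHalfPlane β) (hz : z ∈ tiltedHalfPlane β) :
    w ^ p * hankelIntegral β p w = z ^ p * hankelIntegral β p z := by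
  have hd : ∀ x ∈ tiltedHalfPlane β, HasDerivAt (fun x => x ^ p * hankelIntegral β p x) 0 x := by
    intro x hx
    have hsl := tiltedHalfPlane_subset_slitPlane hβ hx
    refine (((hasDerivAt_id x).cpow_const hsl).mul
      (hasDerivAt_hankelIntegral β p hx)).congr_deriv ?_
    have hx0 : x ≠ 0 := Complex.slitPlane_ne_zero hsl
    have h := hankelIntegral_recurrence β p hx
    simp only [id, mul_one]
    have h1 : x ^ p = x ^ (p - 1) * x := by
      rw [Complex.cpow_sub _ _ hx0, Complex.cpow_one, div_mul_cancel₀ _ hx0]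
    rw [h1]
    linear_combination x ^ (p - 1) * h
  exact (isOpen_tiltedHalfPlane β).is_const_of_deriv_eq_zero
    (convex_tiltedHalfPlane β).isPreconnected
    (fun x hx => (hd x hx).differentiableAt.differentiableWithinAt)
    (fun x hx => (hd x hx).deriv) hw hz

lemma ofReal_mul_exp_mem_tiltedHalfPlane (β : ℝ) {t : ℝ} (ht : 0 < t) :
    (t : ℂ) * Complex.exp (β * Complex.I) ∈ tiltedHalfPlane β := by
  change 0 < ((t : ℂ) * Complex.exp (β * Complex.I) * Complex.exp (-(β * Complex.I))).re
  rw [mul_assoc, ← Complex.exp_add]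
  simpa using ht

lemma inv_Gamma_one_sub {p : ℂ} (hp : 0 < p.re) :
    (Complex.Gamma (1 - p))⁻¹ = Complex.sin (Real.pi * p) / Real.pi * Complex.Gamma p := by
  have h := Complex.Gamma_mul_Gamma_one_sub p
  have hG : Complex.Gamma p ≠ 0 := Complex.Gamma_ne_zero_of_re_pos hp
  have hpi : (Real.pi : ℂ) ≠ 0 := by exact_mod_cast Real.pi_ne_zero
  by_cases hs : Complex.sin (Real.pi * p) = 0
  · rw [hs, div_zero, mul_eq_zero, or_iff_right hG] at h
    simp [h, hs]
  · have h1 : Complex.Gamma (1 - p) = Real.pi / (Complex.sin (Real.pi * p) * Complex.Gamma p) := by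
      field_simp at h ⊢
      linear_combination h
    rw [h1]
    field_simp

lemma cpow_mul_rayIntegral_exp {β : ℝ} (hβ : |β| < Real.pi / 2) (p : ℂ) {t : ℝ} (ht : 0 < t) :
    ((t : ℂ) * Complex.exp (β * Complex.I)) ^ p *
      rayIntegral (fun r : ℝ => Complex.exp (r - β * Complex.I)) β p
        (t * Complex.exp (β * Complex.I)) =
    ∫ x in Ioi t, (Real.exp (-x) : ℂ) * (x : ℂ) ^ (p - 1) := by
  have himg : (fun r : ℝ => t * Real.exp r) '' Ioi 0 = Ioi t := by
    ext x
    constructor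
    · rintro ⟨r, hr, rfl⟩
      have : 1 < Real.exp r := Real.one_lt_exp_iff.2 hr
      show t < t * Real.exp r
      nlinarith
    · intro hx
      have hx' : t < x := hx
      refine ⟨Real.log (x / t), Real.log_pos ((one_lt_div ht).2 hx'), ?_⟩
      have : 0 < x / t := div_pos (ht.trans hx') ht
      simp only [Real.exp_log this]
      field_simp
  rw [← himg, integral_image_eq_integral_abs_deriv_smul (f' := fun r => t * Real.exp r)
    measurableSet_Ioi (fun r _ => ((Real.hasDerivAt_exp r).const_mul t).hasDerivWithinAt)
    (fun x _ y _ h => Real.exp_injective (mul_left_cancel₀ ht.ne' h)), rayIntegral,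
    ← integral_const_mul]
  congr 1 with r
  have hte : (0 : ℝ) < t * Real.exp r := by positivity
  have e0 : (t : ℂ) * Complex.exp (β * Complex.I) * Complex.exp (r - β * Complex.I) =
      (t * Real.exp r : ℝ) := by
    rw [mul_assoc, ← Complex.exp_add]; push_cast; ring_nf
  have e1 : ((t : ℂ) * Complex.exp (β * Complex.I)) ^ p =
      Complex.exp ((Real.log t + β * Complex.I) * p) := by
    rw [Complex.cpow_def_of_ne_zero (mul_ne_zero (by exact_mod_cast ht.ne')
      (Complex.exp_ne_zero _)), Complex.log_ofReal_mul ht (Complex.exp_ne_zero _), Complex.log_exp]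
    · simpa using by linarith [(abs_lt.1 hβ).1, Real.pi_pos]
    · simpa using by linarith [(abs_lt.1 hβ).2, Real.pi_pos]
  have e2 : ((t * Real.exp r : ℝ) : ℂ) ^ (p - 1) * (t * Real.exp r : ℝ) =
      Complex.exp ((Real.log t + r) * p) := by
    have hne : ((t * Real.exp r : ℝ) : ℂ) ≠ 0 := by exact_mod_cast hte.ne'
    rw [Complex.cpow_sub _ _ hne, Complex.cpow_one, div_mul_cancel₀ _ hne,
      Complex.cpow_def_of_ne_zero hne, ← Complex.ofReal_log hte.le,
      Real.log_mul ht.ne' (Real.exp_pos r).ne', Real.log_exp]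
    push_cast; ring_nf
  rw [e0, e1, abs_of_pos hte, Complex.real_smul, mul_left_comm, ← Complex.ofReal_neg,
    ← Complex.ofReal_exp, mul_comm ((t * Real.exp r : ℝ) : ℂ), mul_assoc, e2, ← Complex.exp_add]
  ring_nf

lemma continuous_arcIntegral_exp (a b : ℝ) (p : ℂ) :
    Continuous (arcIntegral (fun θ : ℝ => Complex.exp (θ * Complex.I)) a b p) :=
  continuous_iff_continuousAt.2 fun w => (hasDerivAt_arcIntegral_exp a b p w).continuousAt

lemma tendsto_ofReal_mul_exp (β : ℝ) :
    Tendsto (fun t : ℝ => (t : ℂ) * Complex.exp (β * Complex.I)) (𝓝[>] 0) (𝓝 0) := by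
  have h : Continuous fun t : ℝ => (t : ℂ) * Complex.exp (β * Complex.I) := by fun_prop
  simpa using (h.tendsto 0).mono_left nhdsWithin_le_nhds

/-- **Hankel's formula** for exponents in the right half-plane: let the argument tend to `0`, so
that the arc disappears and the ray becomes Euler's integral. -/
lemma cpow_mul_hankelIntegral_of_re_pos {β : ℝ} (hβ : |β| < Real.pi / 2) {p : ℂ} (hp : 0 < p.re)
    {w : ℂ} (hw : w ∈ tiltedHalfPlane β) :
    w ^ p * hankelIntegral β p w = (Complex.Gamma (1 - p))⁻¹ := by
  have hcos : 0 < Real.cos β := Real.cos_pos_of_mem_Ioo ⟨(abs_lt.1 hβ).1, (abs_lt.1 hβ).2⟩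
  have hlim : Tendsto (fun t : ℝ => ((t : ℂ) * Complex.exp (β * Complex.I)) ^ p *
      hankelIntegral β p (t * Complex.exp (β * Complex.I))) (𝓝[>] 0)
      (𝓝 (Complex.Gamma (1 - p))⁻¹) := by
    have h1 : Tendsto (fun t : ℝ => ∫ x in Ioi t, (Real.exp (-x) : ℂ) * (x : ℂ) ^ (p - 1))
        (𝓝[>] 0) (𝓝 (Complex.Gamma p)) := by
      rw [Complex.Gamma_eq_integral hp]
      have h2 := (aecover_Ioi_of_Ioi (μ := volume) (a := fun t : ℝ => t)
        (l := 𝓝[>] (0 : ℝ)) (A := 0)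
        (tendsto_id.mono_left nhdsWithin_le_nhds)).integral_tendsto_of_countably_generated
        (Complex.GammaIntegral_convergent hp)
      refine h2.congr' ?_
      filter_upwards [self_mem_nhdsWithin] with t ht
      rw [Measure.restrict_restrict measurableSet_Ioi, inter_eq_left.2 (Ioi_subset_Ioi (le_of_lt ht))]
    have h3 : Tendsto (fun t : ℝ => ((t : ℂ) * Complex.exp (β * Complex.I)) ^ p)
        (𝓝[>] 0) (𝓝 0) := by
      have h4 := ((Complex.continuousAt_cpow_const_of_re_pos (z := 0) (w := p)
        (Or.inl le_rfl) hp).tendsto).comp (tendsto_ofReal_mul_exp β)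
      rwa [Complex.zero_cpow (by rintro rfl; simp at hp)] at h4
    have h5 := ((continuous_arcIntegral_exp (-Real.pi - β) (Real.pi - β) p).tendsto 0).comp
      (tendsto_ofReal_mul_exp β)
    have h6 := (h1.const_mul (Complex.sin (Real.pi * p) / Real.pi)).add
      ((h3.mul h5).const_mul (1 / (2 * (Real.pi : ℂ))))
    rw [zero_mul, mul_zero, add_zero, ← inv_Gamma_one_sub hp] at h6
    refine h6.congr' ?_
    filter_upwards [self_mem_nhdsWithin] with t ht
    rw [← cpow_mul_rayIntegral_exp hβ p ht, hankelIntegral]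
    simp only [Function.comp_apply]
    ring
  refine tendsto_nhds_unique (tendsto_const_nhds.congr' ?_) hlim
  filter_upwards [self_mem_nhdsWithin] with t ht
  exact cpow_mul_hankelIntegral_eq hcos p hw (ofReal_mul_exp_mem_tiltedHalfPlane β ht)

lemma hankelIntegral_zero {β : ℝ} (hβ : |β| < Real.pi / 2) {w : ℂ}
    (hw : w ∈ tiltedHalfPlane β) : hankelIntegral β 0 w = 1 := by
  have hcos : 0 < Real.cos β := Real.cos_pos_of_mem_Ioo ⟨(abs_lt.1 hβ).1, (abs_lt.1 hβ).2⟩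
  have hpi : (Real.pi : ℂ) ≠ 0 := by exact_mod_cast Real.pi_ne_zero
  have h5 := (((continuous_arcIntegral_exp (-Real.pi - β) (Real.pi - β) 0).tendsto 0).comp
      (tendsto_ofReal_mul_exp β)).const_mul (1 / (2 * (Real.pi : ℂ)))
  have h0 : arcIntegral (fun θ : ℝ => Complex.exp (θ * Complex.I)) (-Real.pi - β) (Real.pi - β) 0 0
      = 2 * Real.pi := by
    simp [arcIntegral]
    ring
  rw [h0, one_div, inv_mul_cancel₀ (by simp)] at h5
  refine tendsto_nhds_unique (tendsto_const_nhds.congr' ?_) h5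
  filter_upwards [self_mem_nhdsWithin] with t ht
  have := cpow_mul_hankelIntegral_eq hcos 0 hw (ofReal_mul_exp_mem_tiltedHalfPlane β ht)
  rw [Complex.cpow_zero, Complex.cpow_zero, one_mul, one_mul] at this
  rw [this, hankelIntegral]
  simp

/-- **Hankel's formula** `w ^ p * hankelIntegral β p w = 1 / Γ(1 - p)`. -/
lemma cpow_mul_hankelIntegral {β : ℝ} (hβ : |β| < Real.pi / 2) (p : ℂ) {w : ℂ}
    (hw : w ∈ tiltedHalfPlane β) :
    w ^ p * hankelIntegral β p w = (Complex.Gamma (1 - p))⁻¹ := by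
  have hcos : 0 < Real.cos β := Real.cos_pos_of_mem_Ioo ⟨(abs_lt.1 hβ).1, (abs_lt.1 hβ).2⟩
  have hw0 : w ≠ 0 := Complex.slitPlane_ne_zero (tiltedHalfPlane_subset_slitPlane hcos hw)
  obtain ⟨n, hn⟩ := exists_nat_gt (-p.re)
  -- Both sides satisfy the same recursion in `p`, which is run down from `Re p > 0`.
  induction n generalizing p with
  | zero => exact cpow_mul_hankelIntegral_of_re_pos hβ (by simpa using hn) hw
  | succ n ih =>
    by_cases hp : p = 0
    · subst hp
      simp [hankelIntegral_zero hβ hw]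
    · have h := ih (p + 1) (by push_cast at hn; simp; linarith)
      have h1 := Complex.one_div_Gamma_eq_self_mul_one_div_Gamma_add_one (1 - (p + 1))
      rw [show 1 - (p + 1) + 1 = 1 - p by ring] at h1
      rw [h1, Complex.cpow_add _ _ hw0, Complex.cpow_one, mul_assoc,
        hankelIntegral_recurrence β p hw] at h
      refine mul_left_cancel₀ hp ?_
      linear_combination -h

/-! ### Contour integrals for the Bessel functions -/

lemma isExpLike_cosh (β : ℝ) :
    IsExpLike (fun r : ℝ => Complex.cosh (r - β * Complex.I)) β (1 / 2) where
  cont := by fun_prop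
  pos := by norm_num
  near r hr := by
    have h : Complex.cosh (r - β * Complex.I) - ((1 / 2 : ℝ) : ℂ) *
        Complex.exp (r - β * Complex.I) = Complex.exp (-(r - β * Complex.I)) / 2 := by
      rw [Complex.cosh]; push_cast; ring
    rw [h, norm_div, Complex.norm_exp]
    have : Real.exp (-r) ≤ 1 := Real.exp_le_one_iff.2 (by linarith)
    simp only [Complex.neg_re, Complex.sub_re, Complex.ofReal_re, Complex.mul_re, Complex.I_re,
      mul_zero, Complex.ofReal_im, Complex.I_im, mul_one, sub_self, sub_zero, Complex.norm_ofNat]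
    linarith

lemma norm_cos_ofReal_le (θ : ℝ) : ‖Complex.cos θ‖ ≤ 1 := by
  rw [← Complex.ofReal_cos, Complex.norm_real]
  exact Real.abs_cos_le_one θ

lemma sin_sub_natCast_mul_pi (x : ℂ) (n : ℕ) :
    Complex.sin (x - n * Real.pi) = (-1) ^ n * Complex.sin x := by
  induction n with
  | zero => simp
  | succ n ih =>
    rw [show x - ((n + 1 : ℕ) : ℂ) * Real.pi = x - n * Real.pi - Real.pi by push_cast; ring,
      Complex.sin_sub_pi, ih]
    ring

lemma hasSum_rayIntegral_exp {β : ℝ} (p : ℂ) {w : ℂ} (hw : w ∈ tiltedHalfPlane β) :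
    HasSum (fun k : ℕ => (w / 2) ^ k / k.factorial * ((-1) ^ k *
        rayIntegral (fun r : ℝ => Complex.exp (r - β * Complex.I)) β (p - k) (w / 2)))
      (rayIntegral (fun r : ℝ => Complex.cosh (r - β * Complex.I)) β p w) := by
  have h := hasSum_integral_exp_mul
    ((isExpLike_exp β).integrableOn p (div_two_mem_tiltedHalfPlane hw))
    (q := fun r : ℝ => -Complex.exp (-(r - β * Complex.I)))
    (Continuous.aestronglyMeasurable (by fun_prop)) ?_ (w / 2)
  · convert h using 1
    · funext k
      rw [rayIntegral, ← integral_const_mul]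
      congr 2 with r
      have e : Complex.exp ((p - k) * (r - β * Complex.I)) =
          Complex.exp (-(r - β * Complex.I)) ^ k * Complex.exp (p * (r - β * Complex.I)) := by
        rw [← Complex.exp_nat_mul, ← Complex.exp_add]; ring_nf
      rw [neg_pow, e]
      ring
    · rw [rayIntegral]
      congr 1 with r
      rw [← mul_assoc, ← Complex.exp_add (_ * _), Complex.cosh]
      congr 2
      ring
  · filter_upwards [ae_restrict_mem measurableSet_Ioi] with r hr
    have : (0 : ℝ) < r := hr
    rw [norm_neg, Complex.norm_exp, Real.exp_le_one_iff]
    simpa using this.le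

lemma hasSum_arcIntegral_exp (a b : ℝ) (p w : ℂ) :
    HasSum (fun k : ℕ => (w / 2) ^ k / k.factorial *
        arcIntegral (fun θ : ℝ => Complex.exp (θ * Complex.I)) a b (p - k) (w / 2))
      (arcIntegral (fun θ : ℝ => Complex.cos θ) a b p w) := by
  have aux : ∀ c d : ℝ, HasSum (fun k : ℕ => (w / 2) ^ k / k.factorial *
        ∫ θ in Ioc c d, Complex.exp ((w / 2) * Complex.exp (θ * Complex.I)) *
          Complex.exp ((p - k) * (θ * Complex.I)))
      (∫ θ in Ioc c d, Complex.exp (w * Complex.cos θ) * Complex.exp (p * (θ * Complex.I))) := by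
    intro c d
    have hi : IntegrableOn (fun θ : ℝ => Complex.exp ((w / 2) * Complex.exp (θ * Complex.I)) *
          Complex.exp (p * (θ * Complex.I))) (Ioc c d) :=
      Continuous.integrableOn_Ioc (by fun_prop)
    have h := hasSum_integral_exp_mul hi
      (q := fun θ : ℝ => Complex.exp (-(θ * Complex.I)))
      (Continuous.aestronglyMeasurable (by fun_prop))
      (ae_of_all _ fun θ => by rw [Complex.norm_exp]; simp) (w / 2)
    convert h using 1
    · funext k
      congr 2 with r
      rw [← Complex.exp_nat_mul, sub_mul, sub_eq_add_neg, Complex.exp_add]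
      ring_nf
    · congr 1 with r
      have e : Complex.exp (w * Complex.cos r) = Complex.exp (w / 2 *
          Complex.exp (-(r * Complex.I))) * Complex.exp (w / 2 * Complex.exp (r * Complex.I)) := by
        rw [← Complex.exp_add, Complex.cos]; ring_nf
      rw [e, mul_assoc]
  simp only [arcIntegral, intervalIntegral, mul_sub]
  exact (aux a b).sub (aux b a)

/-- **Schläfli's integral** for `I_ν`: expand `exp (w cosh u) = exp ((w/2) eᵘ) exp ((w/2) e⁻ᵘ)` in
powers of `e⁻ᵘ` and apply Hankel's formula to each term. -/
lemma besselI_eq {β : ℝ} (hβ : |β| < Real.pi / 2) (ν : ℂ) {w : ℂ} (hw : w ∈ tiltedHalfPlane β) :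
    besselI ν w =
      -(Complex.sin (ν * Real.pi) / Real.pi) *
          rayIntegral (fun r : ℝ => Complex.cosh (r - β * Complex.I)) β (-ν) w +
        1 / (2 * Real.pi) *
          arcIntegral (fun θ : ℝ => Complex.cos θ) (-Real.pi - β) (Real.pi - β) (-ν) w := by
  have hw2 := div_two_mem_tiltedHalfPlane hw
  have hcos : 0 < Real.cos β := Real.cos_pos_of_mem_Ioo ⟨(abs_lt.1 hβ).1, (abs_lt.1 hβ).2⟩
  have hw0 : w / 2 ≠ 0 := Complex.slitPlane_ne_zero (tiltedHalfPlane_subset_slitPlane hcos hw2)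
  have h := ((hasSum_rayIntegral_exp (-ν) hw).mul_left
    (-(Complex.sin (ν * Real.pi) / Real.pi))).add
    ((hasSum_arcIntegral_exp (-Real.pi - β) (Real.pi - β) (-ν) w).mul_left (1 / (2 * (Real.pi : ℂ))))
  rw [← h.tsum_eq, besselI, ← tsum_mul_left]
  congr 1 with k
  have hH := cpow_mul_hankelIntegral hβ (-ν - k) hw2
  have hsin : Complex.sin (Real.pi * (-ν - k)) = -((-1) ^ k * Complex.sin (ν * Real.pi)) := by
    rw [show (Real.pi : ℂ) * (-ν - k) = -(ν * Real.pi) - k * Real.pi by ring,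
      sin_sub_natCast_mul_pi, Complex.sin_neg]
    ring
  have hpow : (w / 2) ^ (-ν - k) * (w / 2) ^ ν * (w / 2) ^ k = 1 := by
    rw [← Complex.cpow_natCast (w / 2) k, ← Complex.cpow_add _ _ hw0, ← Complex.cpow_add _ _ hw0,
      show -ν - k + ν + k = 0 by ring, Complex.cpow_zero]
  rw [show 1 - (-ν - k) = ν + k + 1 by ring] at hH
  rw [mul_inv, ← hH, hankelIntegral, hsin, two_mul, pow_add]
  generalize rayIntegral _ _ _ _ = R
  generalize arcIntegral _ _ _ _ _ = A
  linear_combination ((w / 2) ^ k * (k.factorial : ℂ)⁻¹ *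
    (-((-1) ^ k * Complex.sin (ν * Real.pi)) / Real.pi * R + 1 / (2 * Real.pi) * A)) * hpow

/-- `½ (∫ exp (-w cosh v - ν v) dv)` over the contour through the segment `[iβ, -iβ]` whose ends
are `-∞ + iβ` and `+∞ - iβ`. It converges for `Re (w e^{-iβ}) > 0`. -/
noncomputable def macdonaldIntegral (β : ℝ) (ν w : ℂ) : ℂ :=
  1 / 2 * (rayIntegral (fun r : ℝ => Complex.cosh (r - β * Complex.I)) β ν w +
    rayIntegral (fun r : ℝ => Complex.cosh (r - β * Complex.I)) β (-ν) w -
    Complex.I * arcIntegral (fun θ : ℝ => Complex.cos θ) (-β) β (-ν) (-w))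

lemma arcIntegral_cos_neg (a b : ℝ) (p w : ℂ) :
    arcIntegral (fun θ : ℝ => Complex.cos θ) (-b) (-a) (-p) w =
      arcIntegral (fun θ : ℝ => Complex.cos θ) a b p w := by
  rw [arcIntegral, arcIntegral, ← intervalIntegral.integral_comp_neg]
  congr 1 with θ
  simp

lemma arcIntegral_cos_add_pi (a b : ℝ) (p w : ℂ) :
    arcIntegral (fun θ : ℝ => Complex.cos θ) (a + Real.pi) (b + Real.pi) p w =
      Complex.exp (p * (Real.pi * Complex.I)) *
        arcIntegral (fun θ : ℝ => Complex.cos θ) a b p (-w) := by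
  rw [arcIntegral, arcIntegral, ← intervalIntegral.integral_comp_add_right,
    ← intervalIntegral.integral_const_mul]
  congr 1 with θ
  push_cast
  rw [Complex.cos_add_pi, add_mul, mul_add, Complex.exp_add]
  ring_nf

lemma arcIntegral_cos_sub_arcIntegral_cos (β : ℝ) (ν w : ℂ) :
    arcIntegral (fun θ : ℝ => Complex.cos θ) (-Real.pi - β) (Real.pi - β) ν w -
      arcIntegral (fun θ : ℝ => Complex.cos θ) (-Real.pi - β) (Real.pi - β) (-ν) w =
    -2 * Complex.I * Complex.sin (ν * Real.pi) *
      arcIntegral (fun θ : ℝ => Complex.cos θ) (-β) β (-ν) (-w) := by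
  have h1 := arcIntegral_cos_neg (-Real.pi - β) (Real.pi - β) ν w
  have h2 := arcIntegral_cos_add_pi β (-β) (-ν) w
  have h3 := arcIntegral_cos_add_pi (-(Real.pi - β)) (-Real.pi - β) (-ν) (-w)
  rw [show -Real.pi - β + Real.pi = -β by ring, show -(Real.pi - β) + Real.pi = β by ring,
    neg_neg] at h3
  have h5 : arcIntegral (fun θ : ℝ => Complex.cos θ) β (-β) (-ν) (-w) =
      -arcIntegral (fun θ : ℝ => Complex.cos θ) (-β) β (-ν) (-w) :=
    intervalIntegral.integral_symm _ _
  have hi : ∀ a b : ℝ, IntervalIntegrable (fun θ : ℝ => Complex.exp (w * Complex.cos θ) *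
      Complex.exp (-ν * (θ * Complex.I))) volume a b :=
    fun a b => Continuous.intervalIntegrable (by fun_prop) _ _
  have h4 := intervalIntegral.integral_interval_sub_interval_comm
    (hi (-(Real.pi - β)) (-(-Real.pi - β))) (hi (-Real.pi - β) (Real.pi - β))
    (hi (-(Real.pi - β)) (-Real.pi - β))
  change arcIntegral (fun θ : ℝ => Complex.cos θ) _ _ (-ν) w -
    arcIntegral (fun θ : ℝ => Complex.cos θ) _ _ (-ν) w =
    arcIntegral (fun θ : ℝ => Complex.cos θ) _ _ (-ν) w -
    arcIntegral (fun θ : ℝ => Complex.cos θ) _ _ (-ν) w at h4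
  have hs := Complex.two_sin (ν * Real.pi)
  have e : Complex.exp (ν * (Real.pi * Complex.I)) * Complex.exp (-ν * (Real.pi * Complex.I)) = 1 := by
    rw [← Complex.exp_add]; simp
  rw [show β + Real.pi = -(-Real.pi - β) by ring, show -β + Real.pi = Real.pi - β by ring] at h2
  rw [h1, h2] at h4
  rw [h5] at h3 h4
  rw [h4]
  rw [show -(ν * Real.pi) * Complex.I = -ν * (Real.pi * Complex.I) by ring,
    mul_assoc ν] at hs
  generalize arcIntegral _ (-(Real.pi - β)) _ _ _ = X at h3 ⊢
  generalize arcIntegral _ (-β) _ _ _ = A at h3 ⊢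
  generalize Complex.exp (ν * (Real.pi * Complex.I)) = E at e hs
  generalize Complex.exp (-ν * (Real.pi * Complex.I)) = F at e hs h3 ⊢
  linear_combination -E * h3 - X * e + Complex.I * A * hs + (F - E) * A * Complex.I_mul_I

lemma continuous_macdonaldIntegral (β : ℝ) {w : ℂ} (hw : w ∈ tiltedHalfPlane β) :
    Continuous fun ν => macdonaldIntegral β ν w := by
  have h1 := (isExpLike_cosh β).continuous_rayIntegral hw
  have h2 := continuous_arcIntegral (c := fun θ : ℝ => Complex.cos θ) (by fun_prop) (-β) β (-w)
  have h3 := h1.comp continuous_neg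
  have h4 := h2.comp continuous_neg
  exact continuous_const.mul ((h1.add h3).sub (continuous_const.mul h4))

lemma differentiableOn_macdonaldIntegral (β : ℝ) (ν : ℂ) :
    DifferentiableOn ℂ (macdonaldIntegral β ν) (tiltedHalfPlane β) := by
  intro w hw
  have h1 := fun p => ((isExpLike_cosh β).hasDerivAt_rayIntegral p hw).differentiableAt
  have h2 : DifferentiableAt ℂ (fun w => arcIntegral (fun θ : ℝ => Complex.cos θ) (-β) β (-ν) (-w)) w :=
    (hasDerivAt_arcIntegral (by fun_prop) norm_cos_ofReal_le _ _ (-ν) (-w)).differentiableAt.comp w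
      differentiableAt_id.neg
  exact ((((h1 ν).add (h1 (-ν))).sub (h2.const_mul _)).const_mul _).differentiableWithinAt

lemma besselI_neg_sub_besselI {β : ℝ} (hβ : |β| < Real.pi / 2) (ν : ℂ)
    (hν : Complex.sin (ν * Real.pi) ≠ 0) {w : ℂ} (hw : w ∈ tiltedHalfPlane β) :
    (Real.pi / 2 : ℂ) * (besselI (-ν) w - besselI ν w) / Complex.sin (ν * Real.pi) =
      macdonaldIntegral β ν w := by
  have hpi : (Real.pi : ℂ) ≠ 0 := by exact_mod_cast Real.pi_ne_zero
  have h := arcIntegral_cos_sub_arcIntegral_cos β ν w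
  rw [besselI_eq hβ ν hw, besselI_eq hβ (-ν) hw, neg_neg, macdonaldIntegral, neg_mul ν,
    Complex.sin_neg]
  generalize arcIntegral _ (-Real.pi - β) _ ν w = A1 at h ⊢
  generalize arcIntegral _ (-Real.pi - β) _ (-ν) w = A0 at h ⊢
  generalize arcIntegral _ _ _ _ _ = A at h ⊢
  generalize Complex.sin (ν * Real.pi) = S at h hν ⊢
  generalize rayIntegral _ _ ν w = R1
  generalize rayIntegral _ _ (-ν) w = R0
  field_simp
  linear_combination h

lemma sin_mul_pi_ne_zero {ν : ℂ} (hν : ¬∃ n : ℤ, ν = n) : Complex.sin (ν * Real.pi) ≠ 0 := by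
  intro h
  obtain ⟨k, hk⟩ := Complex.sin_eq_zero_iff.1 h
  exact hν ⟨k, mul_right_cancel₀ (by exact_mod_cast Real.pi_ne_zero) hk⟩

lemma eventually_not_int (n : ℤ) : ∀ᶠ a : ℂ in 𝓝[≠] (n : ℂ), ¬∃ m : ℤ, a = m := by
  filter_upwards [nhdsWithin_le_nhds (Metric.ball_mem_nhds (n : ℂ) one_pos),
    self_mem_nhdsWithin] with a ha hne
  rintro ⟨m, rfl⟩
  rw [Metric.mem_ball, Complex.dist_eq, ← Int.cast_sub, Complex.norm_intCast] at ha
  have h : |m - n| < 1 := by exact_mod_cast ha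
  exact hne (by rw [show m = n by rw [Int.abs_lt_one_iff] at h; omega]; rfl)

/-- The integral of Macdonald's function, for all orders: at the integers both sides are limits
of their values at non-integer orders. -/
lemma besselK_eq {β : ℝ} (hβ : |β| < Real.pi / 2) (ν : ℂ) {w : ℂ} (hw : w ∈ tiltedHalfPlane β) :
    besselK ν w = macdonaldIntegral β ν w := by
  rw [besselK]
  split_ifs with hν
  · obtain ⟨n, rfl⟩ := hν
    refine Tendsto.limUnder_eq ?_
    refine (((continuous_macdonaldIntegral β hw).tendsto _).mono_left nhdsWithin_le_nhds).congr' ?_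
    filter_upwards [eventually_not_int n] with a ha
    exact (besselI_neg_sub_besselI hβ a (sin_mul_pi_ne_zero ha) hw).symm
  · exact besselI_neg_sub_besselI hβ ν (sin_mul_pi_ne_zero hν) hw

/-! ### Macdonald's function in the closed right half-plane -/

lemma re_mul_cosh_sub_mul_I (β r : ℝ) (w : ℂ) :
    (w * Complex.cosh (r - β * Complex.I)).re =
      w.re * (Real.cosh r * Real.cos β) + w.im * (Real.sinh r * Real.sin β) := by
  rw [Complex.cosh_sub, Complex.cosh_mul_I, Complex.sinh_mul_I, ← Complex.ofReal_cosh,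
    ← Complex.ofReal_sinh, ← Complex.ofReal_cos, ← Complex.ofReal_sin]
  simp [Complex.mul_re, Complex.cos_ofReal_re, Complex.sin_ofReal_re, Complex.sinh_ofReal_re]

/-- On the tilted ray the real part of `w cosh v` grows like `‖w‖ e^r`, uniformly up to the
imaginary axis, and is at least a fixed multiple of `Re w`. -/
lemma le_re_mul_cosh_sub_mul_I {β s : ℝ} (hs : 0 < s) (hcos : s ≤ Real.cos β) {w : ℂ}
    (hw : 0 ≤ w.re) (hsin : s * |w.im| ≤ w.im * Real.sin β) {r : ℝ} (hr : 0 ≤ r) :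
    s / 2 * w.re + s / 4 * min ‖w‖ 1 * Real.exp r - s / 4 ≤
      (w * Complex.cosh (r - β * Complex.I)).re := by
  rw [re_mul_cosh_sub_mul_I]
  have h1 : Real.sinh r = (Real.exp r - Real.exp (-r)) / 2 := Real.sinh_eq r
  have h2 : Real.cosh r = (Real.exp r + Real.exp (-r)) / 2 := Real.cosh_eq r
  have h3 : Real.exp (-r) ≤ 1 := Real.exp_le_one_iff.2 (by linarith)
  have h4 : 1 ≤ Real.exp r := Real.one_le_exp hr
  have h5 : 1 ≤ Real.cosh r := Real.one_le_cosh r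
  have h6 : 0 ≤ Real.sinh r := Real.sinh_nonneg_iff.2 hr
  have h7 : ‖w‖ ≤ w.re + |w.im| := by
    have := Complex.norm_le_abs_re_add_abs_im w
    rwa [abs_of_nonneg hw] at this
  have h8 : 0 ≤ Real.exp (-r) := (Real.exp_pos _).le
  have a1 : w.re * (Real.cosh r * s) ≤ w.re * (Real.cosh r * Real.cos β) := by gcongr
  have a2 : s * |w.im| * Real.sinh r ≤ w.im * (Real.sinh r * Real.sin β) := by
    calc _ ≤ w.im * Real.sin β * Real.sinh r := by gcongr
      _ = _ := by ring
  have a3 : w.re * (1 / 2 + Real.sinh r / 2) ≤ w.re * Real.cosh r := by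
    gcongr; linarith
  have a4 : ‖w‖ * Real.sinh r ≤ (w.re + |w.im|) * Real.sinh r := by gcongr
  have a5 : min ‖w‖ 1 * ((Real.exp r - 1) / 2) ≤ ‖w‖ * Real.sinh r := by
    refine mul_le_mul (min_le_left _ _) (by linarith) (by linarith) (norm_nonneg _)
  have a6 : min ‖w‖ 1 ≤ 1 := min_le_right _ _
  have a7 : 0 ≤ |w.im| * Real.sinh r := by positivity
  have a8 : w.re / 2 + min ‖w‖ 1 * Real.exp r / 4 - 1 / 4 ≤
      w.re * Real.cosh r + |w.im| * Real.sinh r := by nlinarith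
  nlinarith [mul_le_mul_of_nonneg_left a8 hs.le]

lemma min_one_rpow_neg_le {a x : ℝ} (hx : 0 < x) :
    (min x 1) ^ (-a) ≤ 1 + x ^ (-a) := by
  have : 0 ≤ x ^ (-a) := Real.rpow_nonneg hx.le _
  rcases le_total x 1 with h | h
  · rw [min_eq_left h]; linarith
  · rw [min_eq_right h, Real.one_rpow]; linarith

lemma exists_norm_rayIntegral_cosh_le {β s a : ℝ} (hs : 0 < s) (hcos : s ≤ Real.cos β) {p : ℂ}
    (ha : |p.re| < a) : ∃ C : ℝ, 0 ≤ C ∧ ∀ w : ℂ, 0 ≤ w.re → w ≠ 0 →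
      s * |w.im| ≤ w.im * Real.sin β →
      ‖rayIntegral (fun r : ℝ => Complex.cosh (r - β * Complex.I)) β p w‖ ≤
        C * (1 + ‖w‖ ^ (-a)) * Real.exp (-(s / 2 * w.re)) := by
  have ha0 : 0 < a := (abs_nonneg _).trans_lt ha
  set B := Real.exp (s / 4) * Real.exp (p.im * β) * (a ^ a * (s / 4) ^ (-a)) with hB
  have hJ : 0 ≤ ∫ r in Ioi (0 : ℝ), Real.exp ((p.re - a) * r) :=
    integral_nonneg fun r => (Real.exp_pos _).le
  refine ⟨B * ∫ r in Ioi (0 : ℝ), Real.exp ((p.re - a) * r), by positivity, ?_⟩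
  intro w hw hw0 hsin
  have hn : 0 < ‖w‖ := norm_pos_iff.2 hw0
  have hmin : 0 < min ‖w‖ 1 := lt_min hn one_pos
  have hb : ‖rayIntegral (fun r : ℝ => Complex.cosh (r - β * Complex.I)) β p w‖ ≤
      ∫ r in Ioi (0 : ℝ), (B * (1 + ‖w‖ ^ (-a)) * Real.exp (-(s / 2 * w.re))) *
        Real.exp ((p.re - a) * r) := by
    refine norm_integral_le_of_norm_le
      ((integrableOn_exp_mul_Ioi (by linarith [le_abs_self p.re]) 0).const_mul _) ?_
    filter_upwards [ae_restrict_mem measurableSet_Ioi] with r hr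
    have hr' : (0 : ℝ) < r := hr
    have h1 := le_re_mul_cosh_sub_mul_I hs hcos hw hsin hr'.le
    have h2 := exp_neg_mul_exp_mul_exp_le ha0 p.re (t := s / 4 * min ‖w‖ 1) (by positivity) r
    rw [norm_mul, Complex.norm_exp, Complex.norm_exp, Complex.neg_re]
    have h3 : (p * (r - β * Complex.I)).re = p.im * β + p.re * r := by
      simp [Complex.mul_re]; ring
    rw [h3, Real.exp_add]
    calc Real.exp (-(w * Complex.cosh (r - β * Complex.I)).re) *
          (Real.exp (p.im * β) * Real.exp (p.re * r))
        ≤ Real.exp (s / 4 + -(s / 2 * w.re) + -(s / 4 * min ‖w‖ 1 * Real.exp r)) *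
          (Real.exp (p.im * β) * Real.exp (p.re * r)) := by gcongr; linarith
      _ = Real.exp (s / 4) * Real.exp (p.im * β) * Real.exp (-(s / 2 * w.re)) *
          (Real.exp (-(s / 4 * min ‖w‖ 1 * Real.exp r)) * Real.exp (p.re * r)) := by
          rw [Real.exp_add, Real.exp_add]; ring
      _ ≤ Real.exp (s / 4) * Real.exp (p.im * β) * Real.exp (-(s / 2 * w.re)) *
          (a ^ a * (s / 4 * min ‖w‖ 1) ^ (-a) * Real.exp ((p.re - a) * r)) := by gcongr
      _ = Real.exp (s / 4) * Real.exp (p.im * β) * Real.exp (-(s / 2 * w.re)) *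
          (a ^ a * ((s / 4) ^ (-a) * min ‖w‖ 1 ^ (-a)) * Real.exp ((p.re - a) * r)) := by
          rw [Real.mul_rpow (by positivity) hmin.le]
      _ ≤ Real.exp (s / 4) * Real.exp (p.im * β) * Real.exp (-(s / 2 * w.re)) *
          (a ^ a * ((s / 4) ^ (-a) * (1 + ‖w‖ ^ (-a))) * Real.exp ((p.re - a) * r)) := by
          gcongr
          exact min_one_rpow_neg_le hn
      _ = _ := by rw [hB]; ring
  rw [integral_const_mul] at hb
  calc _ ≤ _ := hb
    _ = _ := by ring

lemma norm_arcIntegral_cos_le {β s : ℝ} (hβ : |β| ≤ Real.pi / 2) (hcos : s ≤ Real.cos β) (p : ℂ)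
    {w : ℂ} (hw : 0 ≤ w.re) :
    ‖arcIntegral (fun θ : ℝ => Complex.cos θ) (-β) β p (-w)‖ ≤
      Real.exp (|p.im| * |β|) * |β - -β| * Real.exp (-(s * w.re)) := by
  have h := intervalIntegral.norm_integral_le_of_norm_le_const (a := -β) (b := β)
    (f := fun θ : ℝ => Complex.exp (-w * Complex.cos θ) * Complex.exp (p * (θ * Complex.I)))
    (C := Real.exp (-(s * w.re)) * Real.exp (|p.im| * |β|)) ?_
  · exact h.trans (le_of_eq (by ring))
  · intro θ hθ
    have hθ' : |θ| ≤ |β| := by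
      rcases le_total 0 β with h0 | h0
      · rw [uIoc_of_le (by linarith)] at hθ
        rw [abs_of_nonneg h0]; exact abs_le.2 ⟨hθ.1.le, hθ.2⟩
      · rw [uIoc_of_ge (by linarith)] at hθ
        rw [abs_of_nonpos h0]; exact abs_le.2 ⟨by linarith [hθ.1], hθ.2⟩
    have hc : s ≤ Real.cos θ := by
      rw [← Real.cos_abs θ]
      rw [← Real.cos_abs β] at hcos
      exact hcos.trans (Real.cos_le_cos_of_nonneg_of_le_pi (abs_nonneg _)
        (by linarith [Real.pi_pos]) hθ')
    rw [norm_mul, Complex.norm_exp, Complex.norm_exp]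
    gcongr
    · rw [← Complex.ofReal_cos, Complex.re_mul_ofReal, Complex.neg_re]
      nlinarith
    · have : (p * (θ * Complex.I)).re = -(p.im * θ) := by simp [Complex.mul_re]
      rw [this]
      calc -(p.im * θ) ≤ |p.im * θ| := neg_le_abs _
        _ = |p.im| * |θ| := abs_mul _ _
        _ ≤ _ := by gcongr

lemma exists_norm_macdonaldIntegral_le {β s a : ℝ} (hβ : |β| ≤ Real.pi / 2) (hs : 0 < s)
    (hcos : s ≤ Real.cos β) {ν : ℂ} (ha : |ν.re| < a) : ∃ C : ℝ, 0 ≤ C ∧ ∀ w : ℂ, 0 ≤ w.re → w ≠ 0 →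
      s * |w.im| ≤ w.im * Real.sin β →
      ‖macdonaldIntegral β ν w‖ ≤ C * (1 + ‖w‖ ^ (-a)) * Real.exp (-(s / 2 * w.re)) := by
  obtain ⟨C1, h1, H1⟩ := exists_norm_rayIntegral_cosh_le hs hcos ha
  obtain ⟨C2, h2, H2⟩ := exists_norm_rayIntegral_cosh_le hs hcos (p := -ν) (by simpa using ha)
  set C3 := Real.exp (|(-ν).im| * |β|) * |β - -β| with hC3
  refine ⟨C1 + C2 + C3, by positivity, fun w hw hw0 hsin => ?_⟩
  have e1 := H1 w hw hw0 hsin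
  have e2 := H2 w hw hw0 hsin
  have e3 := norm_arcIntegral_cos_le hβ hcos (-ν) hw
  rw [← hC3] at e3
  have hn : 0 ≤ ‖w‖ ^ (-a) := by positivity
  have e4 : C3 * Real.exp (-(s * w.re)) ≤
      C3 * (1 + ‖w‖ ^ (-a)) * Real.exp (-(s / 2 * w.re)) := by
    have : Real.exp (-(s * w.re)) ≤ Real.exp (-(s / 2 * w.re)) := by
      gcongr; linarith
    have h3 : C3 * 1 ≤ C3 * (1 + ‖w‖ ^ (-a)) := by gcongr; linarith
    rw [mul_one] at h3
    gcongr
  rw [macdonaldIntegral, norm_mul]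
  have e5 := norm_sub_le (rayIntegral (fun r : ℝ => Complex.cosh (r - β * Complex.I)) β ν w +
    rayIntegral (fun r : ℝ => Complex.cosh (r - β * Complex.I)) β (-ν) w)
    (Complex.I * arcIntegral (fun θ : ℝ => Complex.cos θ) (-β) β (-ν) (-w))
  have e6 := norm_add_le (rayIntegral (fun r : ℝ => Complex.cosh (r - β * Complex.I)) β ν w)
    (rayIntegral (fun r : ℝ => Complex.cosh (r - β * Complex.I)) β (-ν) w)
  rw [norm_mul, Complex.norm_I, one_mul] at e5
  have e7 : ‖(1 / 2 : ℂ)‖ ≤ 1 := by norm_num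
  calc _ ≤ 1 * (C1 * (1 + ‖w‖ ^ (-a)) * Real.exp (-(s / 2 * w.re)) +
        C2 * (1 + ‖w‖ ^ (-a)) * Real.exp (-(s / 2 * w.re)) +
        C3 * (1 + ‖w‖ ^ (-a)) * Real.exp (-(s / 2 * w.re))) := by
        gcongr
        linarith
    _ = _ := by ring

lemma abs_pi_div_four_lt : |Real.pi / 4| < Real.pi / 2 := by
  rw [abs_of_pos (by positivity)]; linarith [Real.pi_pos]

lemma abs_neg_pi_div_four_lt : |-(Real.pi / 4)| < Real.pi / 2 := by
  rw [abs_neg]; exact abs_pi_div_four_lt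

/-- The contours tilted by `±π/4` between them reach all of the closed right half-plane. -/
lemma exists_mem_tiltedHalfPlane {w : ℂ} (hw : 0 ≤ w.re) (hw0 : w ≠ 0) :
    (√2 / 2 * |w.im| ≤ w.im * Real.sin (Real.pi / 4) ∧ w ∈ tiltedHalfPlane (Real.pi / 4)) ∨
      (√2 / 2 * |w.im| ≤ w.im * Real.sin (-(Real.pi / 4)) ∧
        w ∈ tiltedHalfPlane (-(Real.pi / 4))) := by
  have h2 : 0 < √2 / 2 := by positivity
  have hpos : 0 < w.re + |w.im| := by
    by_contra! h
    have := abs_nonneg w.im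
    exact hw0 (Complex.ext (by simp; linarith) (by simpa using abs_eq_zero.1 (by linarith)))
  rw [mem_tiltedHalfPlane, mem_tiltedHalfPlane, Real.cos_neg, Real.sin_neg, Real.cos_pi_div_four,
    Real.sin_pi_div_four]
  rcases le_total 0 w.im with h | h
  · left
    rw [abs_of_nonneg h] at *
    constructor <;> nlinarith
  · right
    rw [abs_of_nonpos h] at *
    constructor <;> nlinarith

lemma differentiableAt_besselK (ν : ℂ) {w : ℂ} (hw : 0 ≤ w.re) (hw0 : w ≠ 0) :
    DifferentiableAt ℂ (besselK ν) w := by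
  have key : ∀ β : ℝ, |β| < Real.pi / 2 → w ∈ tiltedHalfPlane β →
      DifferentiableAt ℂ (besselK ν) w := fun β hβ h =>
    ((differentiableOn_macdonaldIntegral β ν).congr fun z hz => besselK_eq hβ ν hz).differentiableAt
      ((isOpen_tiltedHalfPlane β).mem_nhds h)
  rcases exists_mem_tiltedHalfPlane hw hw0 with h | h
  · exact key _ abs_pi_div_four_lt h.2
  · exact key _ abs_neg_pi_div_four_lt h.2

/-- Macdonald's function decays exponentially in `Re w`, uniformly in the closed right
half-plane, and has at `0` at most a singularity of any order above `|Re ν|`. -/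
lemma exists_norm_besselK_le {ν : ℂ} {a : ℝ} (ha : |ν.re| < a) : ∃ C δ : ℝ, 0 ≤ C ∧ 0 < δ ∧
    ∀ w : ℂ, 0 ≤ w.re → w ≠ 0 → ‖besselK ν w‖ ≤ C * (1 + ‖w‖ ^ (-a)) * Real.exp (-(δ * w.re)) := by
  have h2 : 0 < √2 / 2 := by positivity
  obtain ⟨C1, h1, H1⟩ := exists_norm_macdonaldIntegral_le abs_pi_div_four_lt.le h2
    Real.cos_pi_div_four.ge ha
  obtain ⟨C2, h2', H2⟩ := exists_norm_macdonaldIntegral_le abs_neg_pi_div_four_lt.le h2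
    (by rw [Real.cos_neg]; exact Real.cos_pi_div_four.ge) ha
  refine ⟨C1 + C2, √2 / 2 / 2, by positivity, by positivity, fun w hw hw0 => ?_⟩
  rcases exists_mem_tiltedHalfPlane hw hw0 with h | h
  · rw [besselK_eq abs_pi_div_four_lt ν h.2]
    refine (H1 w hw hw0 h.1).trans ?_
    gcongr; linarith
  · rw [besselK_eq abs_neg_pi_div_four_lt ν h.2]
    refine (H2 w hw hw0 h.1).trans ?_
    gcongr; linarith

/-! ### The connection between `J_ν` and `K_ν` -/

lemma I_mul_ofReal_cpow {x : ℝ} (hx : 0 < x) (ν : ℂ) :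
    (Complex.I * x) ^ ν = Complex.exp (ν * Real.pi * Complex.I / 2) * (x : ℂ) ^ ν := by
  have h0 : (x : ℂ) ≠ 0 := by exact_mod_cast hx.ne'
  rw [mul_comm, Complex.cpow_def_of_ne_zero (mul_ne_zero h0 Complex.I_ne_zero),
    Complex.cpow_def_of_ne_zero h0, Complex.log_ofReal_mul hx Complex.I_ne_zero,
    Complex.log_I, ← Complex.ofReal_log hx.le, ← Complex.exp_add]
  ring_nf

lemma neg_I_mul_ofReal_cpow {x : ℝ} (hx : 0 < x) (ν : ℂ) :
    (-(Complex.I * x)) ^ ν = Complex.exp (-(ν * Real.pi * Complex.I / 2)) * (x : ℂ) ^ ν := by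
  have h0 : (x : ℂ) ≠ 0 := by exact_mod_cast hx.ne'
  have hI : -Complex.I ≠ 0 := neg_ne_zero.2 Complex.I_ne_zero
  rw [← neg_mul, mul_comm, Complex.cpow_def_of_ne_zero (mul_ne_zero h0 hI),
    Complex.cpow_def_of_ne_zero h0, Complex.log_ofReal_mul hx hI,
    Complex.log_neg_I, ← Complex.ofReal_log hx.le, ← Complex.exp_add]
  ring_nf

lemma besselI_I_mul (ν : ℂ) {x : ℝ} (hx : 0 < x) :
    besselI ν (Complex.I * x) = Complex.exp (ν * Real.pi * Complex.I / 2) * besselJ ν x := by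
  have e : Complex.I * x / 2 = Complex.I * ((x / 2 : ℝ) : ℂ) := by push_cast; ring
  have e' : (x : ℂ) / 2 = ((x / 2 : ℝ) : ℂ) := by push_cast; ring
  rw [besselI, besselJ, e, e', I_mul_ofReal_cpow (half_pos hx), mul_assoc]
  congr 3 with k
  rw [mul_pow, pow_mul Complex.I, Complex.I_sq]

lemma besselI_neg_I_mul (ν : ℂ) {x : ℝ} (hx : 0 < x) :
    besselI ν (-(Complex.I * x)) =
      Complex.exp (-(ν * Real.pi * Complex.I / 2)) * besselJ ν x := by
  have e : -(Complex.I * x) / 2 = -(Complex.I * ((x / 2 : ℝ) : ℂ)) := by push_cast; ring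
  have e' : (x : ℂ) / 2 = ((x / 2 : ℝ) : ℂ) := by push_cast; ring
  rw [besselI, besselJ, e, e', neg_I_mul_ofReal_cpow (half_pos hx), mul_assoc]
  congr 3 with k
  rw [(even_two_mul k).neg_pow, mul_pow, pow_mul Complex.I, Complex.I_sq]

lemma I_mul_mem_tiltedHalfPlane {x : ℝ} (hx : 0 < x) :
    Complex.I * x ∈ tiltedHalfPlane (Real.pi / 4) := by
  rw [mem_tiltedHalfPlane, Real.sin_pi_div_four]
  simpa using hx

lemma neg_I_mul_mem_tiltedHalfPlane {x : ℝ} (hx : 0 < x) :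
    -(Complex.I * x) ∈ tiltedHalfPlane (-(Real.pi / 4)) := by
  rw [mem_tiltedHalfPlane, Real.sin_neg, Real.sin_pi_div_four]
  simpa using hx

lemma continuous_besselI_order {β : ℝ} (hβ : |β| < Real.pi / 2) {w : ℂ}
    (hw : w ∈ tiltedHalfPlane β) : Continuous fun ν => besselI ν w := by
  simp_rw [besselI_eq hβ _ hw]
  have h1 := (isExpLike_cosh β).continuous_rayIntegral hw
  have h2 := continuous_arcIntegral (c := fun θ : ℝ => Complex.cos θ) (by fun_prop)
    (-Real.pi - β) (Real.pi - β) w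
  have h3 := h1.comp continuous_neg
  have h4 := h2.comp continuous_neg
  exact (Continuous.mul (by fun_prop) h3).add (continuous_const.mul h4)

lemma continuous_besselK_order {β : ℝ} (hβ : |β| < Real.pi / 2) {w : ℂ}
    (hw : w ∈ tiltedHalfPlane β) : Continuous fun ν => besselK ν w := by
  simp_rw [besselK_eq hβ _ hw]
  exact continuous_macdonaldIntegral β hw

lemma continuous_besselJ_order {x : ℝ} (hx : 0 < x) : Continuous fun ν => besselJ ν x := by
  have h : ∀ ν, besselJ ν x =
      Complex.exp (-(ν * Real.pi * Complex.I / 2)) * besselI ν (Complex.I * x) := by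
    intro ν
    rw [besselI_I_mul ν hx, ← mul_assoc, ← Complex.exp_add]
    simp
  simp_rw [h]
  exact Continuous.mul (by fun_prop)
    (continuous_besselI_order abs_pi_div_four_lt (I_mul_mem_tiltedHalfPlane hx))

/-- The connection formula `πi J_ν(x) = e^{-νπi/2} K_ν(-ix) - e^{νπi/2} K_ν(ix)`. -/
lemma pi_mul_I_mul_besselJ (ν : ℂ) {x : ℝ} (hx : 0 < x) :
    Real.pi * Complex.I * besselJ ν x =
      Complex.exp (-(ν * Real.pi * Complex.I / 2)) * besselK ν (-(Complex.I * x)) -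
        Complex.exp (ν * Real.pi * Complex.I / 2) * besselK ν (Complex.I * x) := by
  have key : ∀ a : ℂ, (¬∃ n : ℤ, a = n) → Real.pi * Complex.I * besselJ a x =
      Complex.exp (-(a * Real.pi * Complex.I / 2)) * besselK a (-(Complex.I * x)) -
        Complex.exp (a * Real.pi * Complex.I / 2) * besselK a (Complex.I * x) := by
    intro a ha
    have hs := sin_mul_pi_ne_zero ha
    rw [besselK, besselK, if_neg ha, if_neg ha, besselI_I_mul a hx, besselI_I_mul (-a) hx,
      besselI_neg_I_mul a hx, besselI_neg_I_mul (-a) hx]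
    have h1 : Complex.exp (-(-a * Real.pi * Complex.I / 2)) =
        Complex.exp (a * Real.pi * Complex.I / 2) := by ring_nf
    have h2 : Complex.exp (-a * Real.pi * Complex.I / 2) =
        Complex.exp (-(a * Real.pi * Complex.I / 2)) := by ring_nf
    have h3 := Complex.two_sin (a * Real.pi)
    have h4 : Complex.exp (a * Real.pi * Complex.I) = Complex.exp (a * Real.pi * Complex.I / 2) *
        Complex.exp (a * Real.pi * Complex.I / 2) := by
      rw [← Complex.exp_add]; ring_nf
    have h5 : Complex.exp (-(a * Real.pi) * Complex.I) =
        Complex.exp (-(a * Real.pi * Complex.I / 2)) *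
        Complex.exp (-(a * Real.pi * Complex.I / 2)) := by
      rw [← Complex.exp_add]; ring_nf
    rw [h4, h5] at h3
    rw [h1, h2]
    generalize Complex.exp (-(a * Real.pi * Complex.I / 2)) = F at h3 ⊢
    generalize Complex.exp (a * Real.pi * Complex.I / 2) = E at h3 ⊢
    generalize Complex.sin (a * Real.pi) = S at h3 hs ⊢
    field_simp
    linear_combination Complex.I * besselJ a x * h3 + (F * F - E * E) * besselJ a x *
      Complex.I_mul_I
  by_cases hν : ∃ n : ℤ, ν = n
  · obtain ⟨n, rfl⟩ := hν
    have c1 : Continuous fun a : ℂ => Real.pi * Complex.I * besselJ a x :=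
      continuous_const.mul (continuous_besselJ_order hx)
    have c2 : Continuous fun a : ℂ =>
        Complex.exp (-(a * Real.pi * Complex.I / 2)) * besselK a (-(Complex.I * x)) -
          Complex.exp (a * Real.pi * Complex.I / 2) * besselK a (Complex.I * x) :=
      (Continuous.mul (by fun_prop) (continuous_besselK_order abs_neg_pi_div_four_lt
        (neg_I_mul_mem_tiltedHalfPlane hx))).sub (Continuous.mul (by fun_prop)
        (continuous_besselK_order abs_pi_div_four_lt (I_mul_mem_tiltedHalfPlane hx)))
    refine tendsto_nhds_unique (((c1.tendsto n).mono_left nhdsWithin_le_nhds).congr' ?_)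
      ((c2.tendsto n).mono_left (nhdsWithin_le_nhds (s := {(n : ℂ)}ᶜ)))
    filter_upwards [eventually_not_int n] with a ha
    exact key a ha
  · exact key ν hν

/-! ### Rotation of the path of integration -/

/-- The closed first quadrant without the origin. -/
def firstQuadrant : Set ℂ := {z : ℂ | 0 ≤ z.re ∧ 0 ≤ z.im ∧ z ≠ 0}

lemma integrableOn_of_norm_le_rpow_mul_exp {g : ℝ → ℂ} (hg : ContinuousOn g (Ioi 0)) {C b c : ℝ}
    (hb : b < 1) (hc : 0 < c) (hle : ∀ x : ℝ, 0 < x → ‖g x‖ ≤ C * x ^ (-b) * Real.exp (-(c * x))) :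
    IntegrableOn g (Ioi 0) := by
  have h := (integrableOn_rpow_mul_exp_neg_mul_rpow (p := 1) (s := -b) (b := c) (by linarith)
    one_pos hc).const_mul C
  refine Integrable.mono' h (hg.aestronglyMeasurable measurableSet_Ioi) ?_
  filter_upwards [ae_restrict_mem measurableSet_Ioi] with x hx
  refine (hle x hx).trans (le_of_eq ?_)
  rw [Real.rpow_one, mul_assoc, neg_mul]

lemma integrable_comp_exp {g : ℝ → ℂ} (hg : IntegrableOn g (Ioi 0)) :
    Integrable (fun t : ℝ => g (Real.exp t) * (Real.exp t : ℂ)) := by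
  have h := (integrableOn_image_iff_integrableOn_abs_deriv_smul (s := univ) (f := Real.exp)
    (f' := Real.exp) MeasurableSet.univ (fun x _ => (Real.hasDerivAt_exp x).hasDerivWithinAt)
    Real.exp_injective.injOn g).1 (by rwa [image_univ, Real.range_exp])
  rw [integrableOn_univ] at h
  refine h.congr (ae_of_all _ fun t => ?_)
  simp only [Complex.real_smul, abs_of_pos (Real.exp_pos t), mul_comm]

lemma integral_comp_exp (g : ℝ → ℂ) :
    ∫ t : ℝ, g (Real.exp t) * (Real.exp t : ℂ) = ∫ x in Ioi (0 : ℝ), g x := by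
  have h := integral_image_eq_integral_abs_deriv_smul (s := univ) (f := Real.exp)
    (f' := Real.exp) MeasurableSet.univ (fun x _ => (Real.hasDerivAt_exp x).hasDerivWithinAt)
    Real.exp_injective.injOn g
  rw [image_univ, Real.range_exp, Measure.restrict_univ] at h
  rw [h]
  congr 1 with t
  simp only [Complex.real_smul, abs_of_pos (Real.exp_pos t), mul_comm]

lemma exp_mem_firstQuadrant {u : ℂ} (h0 : 0 ≤ u.im) (h1 : u.im ≤ Real.pi / 2) :
    Complex.exp u ∈ firstQuadrant := by
  refine ⟨?_, ?_, Complex.exp_ne_zero u⟩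
  · rw [Complex.exp_re]
    exact mul_nonneg (Real.exp_pos _).le
      (Real.cos_nonneg_of_neg_pi_div_two_le_of_le (by linarith [Real.pi_pos]) h1)
  · rw [Complex.exp_im]
    exact mul_nonneg (Real.exp_pos _).le
      (Real.sin_nonneg_of_nonneg_of_le_pi h0 (by linarith [Real.pi_pos]))

lemma exp_mem_interior_quadrant {u : ℂ} (h0 : 0 < u.im) (h1 : u.im < Real.pi / 2) :
    Complex.exp u ∈ {z : ℂ | 0 < z.re ∧ 0 < z.im} := by
  refine ⟨?_, ?_⟩
  · rw [Complex.exp_re]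
    exact mul_pos (Real.exp_pos _) (Real.cos_pos_of_mem_Ioo ⟨by linarith [Real.pi_pos], h1⟩)
  · rw [Complex.exp_im]
    exact mul_pos (Real.exp_pos _) (Real.sin_pos_of_pos_of_lt_pi h0 (by linarith [Real.pi_pos]))

/-- Cauchy's theorem for the first quadrant. In the coordinate `u = log z` the quadrant is a strip,
and the two vertical sides of a long rectangle in it replace the small and the large arc. -/
lemma integral_Ioi_eq_I_mul_integral {h : ℂ → ℂ} (hcont : ContinuousOn h firstQuadrant)
    (hdiff : DifferentiableOn ℂ h {z : ℂ | 0 < z.re ∧ 0 < z.im}) {C b c : ℝ} (hb : b < 1)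
    (hc : 0 < c) (hle : ∀ z ∈ firstQuadrant, ‖h z‖ ≤ C * ‖z‖ ^ (-b) * Real.exp (-(c * ‖z‖))) :
    IntegrableOn (fun x : ℝ => h x) (Ioi 0) ∧
      IntegrableOn (fun x : ℝ => h (Complex.I * x)) (Ioi 0) ∧
      ∫ x in Ioi (0 : ℝ), h x = Complex.I * ∫ x in Ioi (0 : ℝ), h (Complex.I * x) := by
  have hm1 : ∀ x : ℝ, 0 < x → (x : ℂ) ∈ firstQuadrant := fun x hx =>
    ⟨by simpa using hx.le, by simp, by exact_mod_cast hx.ne'⟩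
  have hm2 : ∀ x : ℝ, 0 < x → Complex.I * (x : ℂ) ∈ firstQuadrant := fun x hx =>
    ⟨by simp, by simpa using hx.le,
      mul_ne_zero Complex.I_ne_zero (by exact_mod_cast hx.ne')⟩
  have hi1 : IntegrableOn (fun x : ℝ => h x) (Ioi 0) := by
    refine integrableOn_of_norm_le_rpow_mul_exp
      (hcont.comp (by fun_prop) fun x hx => hm1 x hx) hb hc (C := C) fun x hx => ?_
    simpa [abs_of_pos hx] using hle _ (hm1 x hx)
  have hi2 : IntegrableOn (fun x : ℝ => h (Complex.I * x)) (Ioi 0) := by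
    refine integrableOn_of_norm_le_rpow_mul_exp
      (hcont.comp (by fun_prop) fun x hx => hm2 x hx) hb hc (C := C) fun x hx => ?_
    simpa [abs_of_pos hx] using hle _ (hm2 x hx)
  refine ⟨hi1, hi2, ?_⟩
  set φ : ℂ → ℂ := fun u => h (Complex.exp u) * Complex.exp u with hφ
  have hrect : ∀ R : ℝ, 0 < R → (∫ x in (-R)..R, h (Real.exp x) * (Real.exp x : ℂ)) -
      (∫ x in (-R)..R, Complex.I * (h (Complex.I * Real.exp x) * (Real.exp x : ℂ))) +
      (Complex.I * ∫ y in (0 : ℝ)..(Real.pi / 2), φ (R + y * Complex.I)) -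
      (Complex.I * ∫ y in (0 : ℝ)..(Real.pi / 2), φ (-R + y * Complex.I)) = 0 := by
    intro R hR
    have hR' : -R ≤ R := by linarith
    have hp : (0 : ℝ) ≤ Real.pi / 2 := by positivity
    have hre1 : (-(R : ℂ)).re = -R := by simp
    have hre2 : ((R : ℂ) + (Real.pi / 2 : ℝ) * Complex.I).re = R := by
      simp [Complex.add_re, Complex.mul_re]
    have him1 : (-(R : ℂ)).im = 0 := by simp
    have him2 : ((R : ℂ) + (Real.pi / 2 : ℝ) * Complex.I).im = Real.pi / 2 := by
      rw [Complex.add_im, Complex.im_ofReal_mul]; simp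
    have e1 : ∀ x : ℝ, φ (x + (0 : ℝ) * Complex.I) = h (Real.exp x) * (Real.exp x : ℂ) :=
      fun x => by simp [hφ]
    have e2 : ∀ x : ℝ, φ (x + (Real.pi / 2 : ℝ) * Complex.I) =
        Complex.I * (h (Complex.I * Real.exp x) * (Real.exp x : ℂ)) := fun x => by
      simp only [hφ]
      rw [Complex.exp_add, Complex.ofReal_div, Complex.ofReal_ofNat,
        Complex.exp_pi_div_two_mul_I, ← Complex.ofReal_exp, mul_comm (Real.exp _ : ℂ)]
      ring
    have hc1 := Complex.integral_boundary_rect_eq_zero_of_continuousOn_of_differentiableOn φ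
      (-(R : ℂ)) (R + (Real.pi / 2 : ℝ) * Complex.I) ?_ ?_
    · rw [hre1, hre2, him1, him2] at hc1
      rw [smul_eq_mul, smul_eq_mul, Complex.ofReal_neg] at hc1
      simp only [e1, e2] at hc1
      exact hc1
    · rw [hre1, hre2, him1, him2, uIcc_of_le hR', uIcc_of_le hp]
      refine ContinuousOn.mul (hcont.comp (by fun_prop) fun u hu => ?_) (by fun_prop)
      rw [Complex.mem_reProdIm] at hu
      exact exp_mem_firstQuadrant hu.2.1 hu.2.2
    · rw [hre1, hre2, him1, him2, min_eq_left hp, max_eq_right hp]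
      refine DifferentiableOn.mul (hdiff.comp (by fun_prop) fun u hu => ?_) (by fun_prop)
      rw [Complex.mem_reProdIm] at hu
      exact exp_mem_interior_quadrant hu.2.1 hu.2.2
  -- On the vertical side with abscissa `a R` the integrand is at most
  -- `C e^{a(1-b)} exp (-c eᵃ)`, which tends to `0` both for `a → ∞` (as `c > 0`) and for
  -- `a → -∞` (as `b < 1`).
  have hvert : ∀ {l : Filter ℝ} {a : ℝ → ℝ},
      Tendsto (fun R => Real.exp (a R) ^ (1 - b) * Real.exp (-c * Real.exp (a R))) l (𝓝 0) →
      Tendsto (fun R => Complex.I * ∫ y in (0 : ℝ)..(Real.pi / 2), φ (a R + y * Complex.I)) l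
        (𝓝 0) := by
    intro l a ha
    have ha' := (ha.const_mul C).mul_const |Real.pi / 2 - 0|
    rw [mul_zero, zero_mul] at ha'
    refine squeeze_zero_norm (fun R => ?_) ha'
    rw [norm_mul, Complex.norm_I, one_mul]
    refine intervalIntegral.norm_integral_le_of_norm_le_const fun y hy => ?_
    rw [uIoc_of_le (by positivity)] at hy
    have him : ((a R : ℂ) + y * Complex.I).im = y := by simp
    have hnorm : ‖Complex.exp ((a R : ℂ) + y * Complex.I)‖ = Real.exp (a R) := by
      rw [Complex.norm_exp]; simp
    have h1 := hle _ (exp_mem_firstQuadrant (u := (a R : ℂ) + y * Complex.I)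
      (by rw [him]; exact hy.1.le) (by rw [him]; exact hy.2))
    rw [hnorm] at h1
    simp only [hφ]
    rw [norm_mul, hnorm, sub_eq_add_neg 1 b, Real.rpow_add (Real.exp_pos _), Real.rpow_one]
    calc _ ≤ C * Real.exp (a R) ^ (-b) * Real.exp (-(c * Real.exp (a R))) * Real.exp (a R) := by
          gcongr
      _ = _ := by rw [neg_mul]; ring
  have hv1 : Tendsto (fun R : ℝ => Complex.I *
      ∫ y in (0 : ℝ)..(Real.pi / 2), φ (R + y * Complex.I)) atTop (𝓝 0) :=
    hvert (a := fun R => R) ((tendsto_rpow_mul_exp_neg_mul_atTop_nhds_zero (1 - b) c hc).comp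
      Real.tendsto_exp_atTop)
  have hv2 : Tendsto (fun R : ℝ => Complex.I *
      ∫ y in (0 : ℝ)..(Real.pi / 2), φ (-R + y * Complex.I)) atTop (𝓝 0) := by
    have h1 : Continuous fun t : ℝ => t ^ (1 - b) * Real.exp (-c * t) :=
      (Real.continuous_rpow_const (by linarith)).mul (by fun_prop)
    have h2 := (h1.tendsto 0).comp Real.tendsto_exp_neg_atTop_nhds_zero
    rw [Real.zero_rpow (by linarith), zero_mul] at h2
    simpa using hvert (a := fun R => -R) h2
  have hl1 := intervalIntegral_tendsto_integral (integrable_comp_exp hi1)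
    tendsto_neg_atTop_atBot tendsto_id
  have hl2 := intervalIntegral_tendsto_integral ((integrable_comp_exp hi2).const_mul Complex.I)
    tendsto_neg_atTop_atBot tendsto_id
  have hlim := ((hl1.sub hl2).add hv1).sub hv2
  rw [integral_const_mul, integral_comp_exp (fun x => h x),
    integral_comp_exp (fun x => h (Complex.I * x)), add_zero, sub_zero] at hlim
  refine sub_eq_zero.1 (tendsto_nhds_unique hlim (tendsto_const_nhds.congr' ?_))
  filter_upwards [eventually_gt_atTop 0] with R hR
  exact (hrect R hR).symm

/-! ### Abel limits -/

namespace HasAbelIntegral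

lemma add {g h : ℝ → ℂ} {L M : ℂ} (hg : HasAbelIntegral g L) (hh : HasAbelIntegral h M) :
    HasAbelIntegral (fun x => g x + h x) (L + M) := by
  refine ⟨fun s hs => ?_, (hg.2.add hh.2).congr' ?_⟩
  · simp only [add_mul]
    exact (hg.1 s hs).add (hh.1 s hs)
  · filter_upwards [self_mem_nhdsWithin] with s hs
    simp only [add_mul]
    rw [integral_add (hg.1 s hs) (hh.1 s hs)]

lemma const_mul {g : ℝ → ℂ} {L : ℂ} (hg : HasAbelIntegral g L) (c : ℂ) :
    HasAbelIntegral (fun x => c * g x) (c * L) := by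
  simp only [HasAbelIntegral, mul_assoc]
  exact ⟨fun s hs => (hg.1 s hs).const_mul c,
    by simpa only [integral_const_mul] using hg.2.const_mul c⟩

lemma congr {g h : ℝ → ℂ} {L : ℂ} (hg : HasAbelIntegral g L) (hgh : ∀ x, 0 < x → g x = h x) :
    HasAbelIntegral h L := by
  have e : ∀ s : ℝ, EqOn (fun x : ℝ => g x * Complex.exp (-(s * x)))
      (fun x : ℝ => h x * Complex.exp (-(s * x))) (Ioi 0) := fun s x hx => by
    simp only [hgh x hx]
  refine ⟨fun s hs => (hg.1 s hs).congr_fun (e s) measurableSet_Ioi, hg.2.congr fun s => ?_⟩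
  exact setIntegral_congr_fun measurableSet_Ioi (e s)

lemma conj {g : ℝ → ℂ} {L : ℂ} (hg : HasAbelIntegral g L) :
    HasAbelIntegral (fun x => starRingEnd ℂ (g x)) (starRingEnd ℂ L) := by
  have e : ∀ s x : ℝ, starRingEnd ℂ (g x) * Complex.exp (-(s * x)) =
      starRingEnd ℂ (g x * Complex.exp (-(s * x))) := fun s x => by
    rw [map_mul, ← Complex.exp_conj]; simp
  simp only [HasAbelIntegral, e, integral_conj]
  refine ⟨fun s hs => ?_, ?_⟩
  · exact (Complex.conjLIE.integrable_comp_iff).2 (hg.1 s hs)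
  · exact (Complex.continuous_conj.tendsto L).comp hg.2

end HasAbelIntegral

/-- An absolutely convergent integral is its own Abel limit. -/
lemma MeasureTheory.IntegrableOn.hasAbelIntegral {g : ℝ → ℂ} (hg : IntegrableOn g (Ioi 0)) :
    HasAbelIntegral g (∫ x in Ioi (0 : ℝ), g x) := by
  have hle : ∀ s : ℝ, 0 < s → ∀ᵐ x ∂volume.restrict (Ioi (0 : ℝ)),
      ‖g x * Complex.exp (-(s * x))‖ ≤ ‖g x‖ := by
    intro s hs
    filter_upwards [ae_restrict_mem measurableSet_Ioi] with x hx
    have hx' : (0 : ℝ) < x := hx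
    rw [norm_mul, Complex.norm_exp]
    refine mul_le_of_le_one_right (norm_nonneg _) (Real.exp_le_one_iff.2 ?_)
    simpa using (mul_pos hs hx').le
  have hmeas : ∀ s : ℝ, AEStronglyMeasurable (fun x : ℝ => g x * Complex.exp (-(s * x)))
      (volume.restrict (Ioi 0)) := fun s =>
    hg.aestronglyMeasurable.mul (Continuous.aestronglyMeasurable (by fun_prop))
  refine ⟨fun s hs => Integrable.mono' hg.norm (hmeas s) (hle s hs), ?_⟩
  refine tendsto_integral_filter_of_dominated_convergence (fun x => ‖g x‖)
    (Eventually.of_forall hmeas) ?_ hg.norm (ae_of_all _ fun x => ?_)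
  · filter_upwards [self_mem_nhdsWithin] with s hs using hle s hs
  · have : Continuous fun s : ℝ => g x * Complex.exp (-(s * x)) := by fun_prop
    simpa using (this.tendsto 0).mono_left nhdsWithin_le_nhds

lemma exists_one_add_pow_le_exp (n : ℕ) {m : ℝ} (hm : 0 < m) :
    ∃ C : ℝ, 0 ≤ C ∧ ∀ t : ℝ, 0 ≤ t → (1 + t) ^ n ≤ C * Real.exp (m * t) := by
  refine ⟨n.factorial / m ^ n * Real.exp m, by positivity, fun t ht => ?_⟩
  have h := Real.pow_div_factorial_le_exp (m * (1 + t)) (by positivity) n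
  rw [div_le_iff₀ (by positivity), mul_pow, mul_add, mul_one, Real.exp_add] at h
  rw [div_mul_eq_mul_div, div_mul_eq_mul_div, le_div_iff₀ (by positivity)]
  linarith

/-- The Abel integral of `k` along the positive real axis may be moved to the positive imaginary
axis if `k` decays exponentially in `Im z`: for every `s > 0`, the factor `e^{-sz}` supplies the
decay in `Re z`, and on the imaginary axis it has absolute value `1`. -/
lemma hasAbelIntegral_of_firstQuadrant {k : ℂ → ℂ} (hcont : ContinuousOn k firstQuadrant)
    (hdiff : DifferentiableOn ℂ k {z : ℂ | 0 < z.re ∧ 0 < z.im}) {C b δ : ℝ} {n : ℕ} (hC : 0 ≤ C)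
    (hb : b < 1) (hδ : 0 < δ) (hle : ∀ z ∈ firstQuadrant,
      ‖k z‖ ≤ C * ‖z‖ ^ (-b) * (1 + ‖z‖) ^ n * Real.exp (-(δ * z.im))) :
    IntegrableOn (fun x : ℝ => k (Complex.I * x)) (Ioi 0) ∧
      HasAbelIntegral (fun x : ℝ => k x)
        (Complex.I * ∫ x in Ioi (0 : ℝ), k (Complex.I * x)) := by
  have hm2 : ∀ x : ℝ, 0 < x → Complex.I * (x : ℂ) ∈ firstQuadrant := fun x hx =>
    ⟨by simp, by simpa using hx.le,
      mul_ne_zero Complex.I_ne_zero (by exact_mod_cast hx.ne')⟩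
  have hcI : ContinuousOn (fun x : ℝ => k (Complex.I * x)) (Ioi 0) :=
    hcont.comp (by fun_prop) fun x hx => hm2 x hx
  have hint : IntegrableOn (fun x : ℝ => k (Complex.I * x)) (Ioi 0) := by
    obtain ⟨D, hD, H⟩ := exists_one_add_pow_le_exp n (half_pos hδ)
    refine integrableOn_of_norm_le_rpow_mul_exp hcI hb (half_pos hδ) (C := C * D) fun x hx => ?_
    have h1 := hle _ (hm2 x hx)
    rw [norm_mul, Complex.norm_I, one_mul, Complex.norm_real, Real.norm_of_nonneg hx.le] at h1
    have h2 : (Complex.I * (x : ℂ)).im = x := by simp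
    rw [h2] at h1
    refine h1.trans ?_
    calc _ ≤ C * x ^ (-b) * (D * Real.exp (δ / 2 * x)) * Real.exp (-(δ * x)) := by
          gcongr; exact H x hx.le
      _ = C * D * x ^ (-b) * (Real.exp (δ / 2 * x) * Real.exp (-(δ * x))) := by ring
      _ = _ := by rw [← Real.exp_add]; ring_nf
  have hrot : ∀ s : ℝ, 0 < s →
      IntegrableOn (fun x : ℝ => k x * Complex.exp (-(s * x))) (Ioi 0) ∧
      IntegrableOn (fun x : ℝ => k (Complex.I * x) * Complex.exp (-(s * (Complex.I * x))))
        (Ioi 0) ∧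
      ∫ x in Ioi (0 : ℝ), k x * Complex.exp (-(s * x)) =
        Complex.I * ∫ x in Ioi (0 : ℝ),
          k (Complex.I * x) * Complex.exp (-(s * (Complex.I * x))) := fun s hs => by
    obtain ⟨D, hD, H⟩ := exists_one_add_pow_le_exp n (half_pos (lt_min hδ hs))
    exact integral_Ioi_eq_I_mul_integral (h := fun z => k z * Complex.exp (-(s * z)))
      (hcont.mul (by fun_prop)) (hdiff.mul (by fun_prop)) (C := C * D) hb
      (half_pos (lt_min hδ hs)) (fun z hz => by
        have h1 : ‖Complex.exp (-(s * z))‖ = Real.exp (-(s * z.re)) := by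
          rw [Complex.norm_exp]; simp
        have h2 : min δ s * ‖z‖ ≤ δ * z.im + s * z.re := by
          have h3 := Complex.norm_le_abs_re_add_abs_im z
          rw [abs_of_nonneg hz.1, abs_of_nonneg hz.2.1] at h3
          have h4 : min δ s * z.im ≤ δ * z.im := by
            have := hz.2.1; gcongr; exact min_le_left _ _
          have h5 : min δ s * z.re ≤ s * z.re := by
            have := hz.1; gcongr; exact min_le_right _ _
          have h6 : min δ s * ‖z‖ ≤ min δ s * (z.re + z.im) := by
            have := (lt_min hδ hs).le; gcongr
          linarith
        rw [norm_mul, h1]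
        calc _ ≤ C * ‖z‖ ^ (-b) * (1 + ‖z‖) ^ n * Real.exp (-(δ * z.im)) *
              Real.exp (-(s * z.re)) := by gcongr; exact hle z hz
          _ = C * ‖z‖ ^ (-b) * (1 + ‖z‖) ^ n * Real.exp (-(δ * z.im + s * z.re)) := by
              rw [mul_assoc, ← Real.exp_add]; ring_nf
          _ ≤ C * ‖z‖ ^ (-b) * (D * Real.exp (min δ s / 2 * ‖z‖)) *
              Real.exp (-(min δ s * ‖z‖)) := by gcongr; exact H _ (norm_nonneg z)
          _ = C * D * ‖z‖ ^ (-b) * (Real.exp (min δ s / 2 * ‖z‖) *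
              Real.exp (-(min δ s * ‖z‖))) := by ring
          _ = _ := by rw [← Real.exp_add]; ring_nf)
  refine ⟨hint, fun s hs => (hrot s hs).1, ?_⟩
  have hlim : Tendsto (fun s : ℝ => ∫ x in Ioi (0 : ℝ),
      k (Complex.I * x) * Complex.exp (-(s * (Complex.I * x)))) (𝓝[>] 0)
      (𝓝 (∫ x in Ioi (0 : ℝ), k (Complex.I * x))) := by
    refine tendsto_integral_filter_of_dominated_convergence (fun x => ‖k (Complex.I * x)‖)
      (Eventually.of_forall fun s => hint.aestronglyMeasurable.mul
        (Continuous.aestronglyMeasurable (by fun_prop))) ?_ hint.norm (ae_of_all _ fun x => ?_)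
    · refine Eventually.of_forall fun s => ae_of_all _ fun x => ?_
      rw [norm_mul, Complex.norm_exp]
      simp
    · have : Continuous fun s : ℝ => k (Complex.I * x) * Complex.exp (-(s * (Complex.I * x))) := by
        fun_prop
      simpa using (this.tendsto 0).mono_left nhdsWithin_le_nhds
  refine (hlim.const_mul Complex.I).congr' ?_
  filter_upwards [self_mem_nhdsWithin] with s hs
  exact (hrot s hs).2.2.symm

/-- The mirror image of `hasAbelIntegral_of_firstQuadrant` in the fourth quadrant. -/
lemma hasAbelIntegral_of_fourthQuadrant {k : ℂ → ℂ}
    (hcont : ContinuousOn k {z : ℂ | 0 ≤ z.re ∧ z.im ≤ 0 ∧ z ≠ 0})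
    (hdiff : DifferentiableOn ℂ k {z : ℂ | 0 < z.re ∧ z.im < 0}) {C b δ : ℝ} {n : ℕ} (hC : 0 ≤ C)
    (hb : b < 1) (hδ : 0 < δ) (hle : ∀ z : ℂ, 0 ≤ z.re → z.im ≤ 0 → z ≠ 0 →
      ‖k z‖ ≤ C * ‖z‖ ^ (-b) * (1 + ‖z‖) ^ n * Real.exp (δ * z.im)) :
    IntegrableOn (fun x : ℝ => k (-(Complex.I * x))) (Ioi 0) ∧
      HasAbelIntegral (fun x : ℝ => k x)
        (-Complex.I * ∫ x in Ioi (0 : ℝ), k (-(Complex.I * x))) := by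
  have hmem : ∀ z ∈ firstQuadrant, 0 ≤ (starRingEnd ℂ z).re ∧ (starRingEnd ℂ z).im ≤ 0 ∧
      starRingEnd ℂ z ≠ 0 := fun z hz =>
    ⟨by simpa using hz.1, by simpa using hz.2.1, by simpa using hz.2.2⟩
  have h := hasAbelIntegral_of_firstQuadrant
    (k := fun z => starRingEnd ℂ (k (starRingEnd ℂ z)))
    (Complex.continuous_conj.comp_continuousOn
      (hcont.comp Complex.continuous_conj.continuousOn fun z hz => hmem z hz))
    (fun z hz => ?_) hC hb hδ (n := n) (fun z hz => ?_)
  · obtain ⟨h1, h2⟩ := h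
    have e : ∀ x : ℝ, starRingEnd ℂ (Complex.I * x) = -(Complex.I * x) := fun x => by simp
    simp only [e] at h1 h2
    refine ⟨?_, ?_⟩
    · exact (Complex.conjLIE.integrable_comp_iff).1 h1
    · have h3 := h2.conj
      simpa [integral_conj] using h3
  · have hz' : starRingEnd ℂ z ∈ {z : ℂ | 0 < z.re ∧ z.im < 0} :=
      ⟨by simpa using hz.1, by simpa using hz.2⟩
    have ho : IsOpen {z : ℂ | 0 < z.re ∧ z.im < 0} :=
      (isOpen_lt continuous_const Complex.continuous_re).inter
        (isOpen_lt Complex.continuous_im continuous_const)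
    have h1 := (hdiff.differentiableAt (ho.mem_nhds hz')).conj_conj
    rw [Complex.conj_conj] at h1
    exact h1.differentiableWithinAt
  · have h1 := hle _ (hmem z hz).1 (hmem z hz).2.1 (hmem z hz).2.2
    simpa using h1

/-! ### Rotation for functions of polynomial growth -/

/-- The growth conditions at `∞` and at `0`, together with compactness in between, bound `f` by a
polynomial in `‖z‖`, up to the boundary of the half-plane. -/
lemma exists_norm_le_one_add_pow {f : ℂ → ℂ}
    (hfc : ContinuousOn f {z : ℂ | 0 ≤ z.re ∧ z ≠ 0})
    (hinf : ∃ K σ : ℝ, ∀ᶠ z in Bornology.cobounded ℂ ⊓ 𝓟 {z : ℂ | 0 < z.re},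
      ‖f z‖ ≤ K * ‖z‖ ^ σ)
    (hzero : ∃ M : ℝ, ∀ᶠ z in 𝓝[{z : ℂ | 0 < z.re}] 0, ‖f z‖ ≤ M) :
    ∃ (C : ℝ) (n : ℕ), 0 ≤ C ∧ ∀ z : ℂ, 0 ≤ z.re → z ≠ 0 → ‖f z‖ ≤ C * (1 + ‖z‖) ^ n := by
  obtain ⟨K, σ, hK⟩ := hinf
  obtain ⟨M, hM⟩ := hzero
  rw [eventually_inf_principal, ← comap_norm_atTop, eventually_comap] at hK
  obtain ⟨R, hR⟩ := eventually_atTop.1 hK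
  rw [eventually_nhdsWithin_iff, Metric.eventually_nhds_iff] at hM
  obtain ⟨r, hr, hM⟩ := hM
  have hcomp : IsCompact {z : ℂ | 0 ≤ z.re ∧ r ≤ ‖z‖ ∧ ‖z‖ ≤ max R 1} := by
    refine Metric.isCompact_of_isClosed_isBounded ?_ ?_
    · exact (isClosed_le continuous_const Complex.continuous_re).inter
        ((isClosed_le continuous_const continuous_norm).inter
          (isClosed_le continuous_norm continuous_const))
    · exact (Metric.isBounded_closedBall (x := (0 : ℂ)) (r := max R 1)).subset fun z hz => by
        simpa using hz.2.2
  obtain ⟨B, hB⟩ := hcomp.exists_bound_of_continuousOn (hfc.mono fun z hz =>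
    ⟨hz.1, norm_pos_iff.1 (hr.trans_le hz.2.1)⟩)
  set n := ⌈|σ|⌉₊ with hn
  refine ⟨|K| + |M| + |B|, n, by positivity, ?_⟩
  have hopen : ∀ z : ℂ, 0 < z.re → ‖f z‖ ≤ (|K| + |M| + |B|) * (1 + ‖z‖) ^ n := by
    intro z hz
    have h1 : 1 ≤ (1 + ‖z‖) ^ n := one_le_pow₀ (by linarith [norm_nonneg z])
    have hsplit : (|K| + |M| + |B|) * (1 + ‖z‖) ^ n = |K| * (1 + ‖z‖) ^ n +
      |M| * (1 + ‖z‖) ^ n + |B| * (1 + ‖z‖) ^ n := by ring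
    have p1 : 0 ≤ |K| * (1 + ‖z‖) ^ n := by positivity
    have p2 : |M| ≤ |M| * (1 + ‖z‖) ^ n := le_mul_of_one_le_right (abs_nonneg _) h1
    have p3 : |B| ≤ |B| * (1 + ‖z‖) ^ n := le_mul_of_one_le_right (abs_nonneg _) h1
    have q2 := abs_nonneg M
    have q3 := abs_nonneg B
    rw [hsplit]
    rcases lt_or_ge ‖z‖ r with h | h
    · have := hM (by simpa using h) hz
      linarith [le_abs_self M]
    · rcases le_or_gt ‖z‖ (max R 1) with h' | h'
      · have := hB z ⟨hz.le, h, h'⟩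
        linarith [le_abs_self B]
      · have hz1 : 1 ≤ ‖z‖ := (le_max_right R 1).trans h'.le
        have h2 := hR ‖z‖ ((le_max_left R 1).trans h'.le) z rfl hz
        have h3 : ‖z‖ ^ σ ≤ (1 + ‖z‖) ^ n := by
          calc ‖z‖ ^ σ ≤ ‖z‖ ^ (n : ℝ) := Real.rpow_le_rpow_of_exponent_le hz1
                ((le_abs_self σ).trans (Nat.le_ceil _))
            _ = ‖z‖ ^ n := Real.rpow_natCast _ _
            _ ≤ _ := by gcongr; linarith
        have h4 : K * ‖z‖ ^ σ ≤ |K| * (1 + ‖z‖) ^ n :=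
          mul_le_mul (le_abs_self K) h3 (by positivity) (abs_nonneg K)
        linarith
  intro z hz hz0
  -- Approach a boundary point along the horizontal line through it.
  have hpath : Tendsto (fun t : ℝ => z + t) (𝓝[>] 0) (𝓝[{z : ℂ | 0 ≤ z.re ∧ z ≠ 0}] z) := by
    refine tendsto_nhdsWithin_iff.2 ⟨?_, ?_⟩
    · have h : Continuous fun t : ℝ => z + (t : ℂ) := by fun_prop
      simpa using (h.tendsto 0).mono_left nhdsWithin_le_nhds
    · filter_upwards [self_mem_nhdsWithin] with t ht
      have ht' : 0 < t := ht
      have : 0 < (z + (t : ℂ)).re := by simp; linarith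
      exact ⟨this.le, fun h => by rw [h] at this; simp at this⟩
  have hl := ((hfc z ⟨hz, hz0⟩).tendsto.comp hpath).norm
  have hc : Continuous fun w : ℂ => (|K| + |M| + |B|) * (1 + ‖w‖) ^ n := by fun_prop
  refine le_of_tendsto_of_tendsto hl
    ((hc.tendsto z).comp (hpath.mono_right nhdsWithin_le_nhds)) ?_
  filter_upwards [self_mem_nhdsWithin] with t ht
  have ht' : 0 < t := ht
  exact hopen _ (by simp; linarith)

lemma norm_cpow_le_rpow_mul_exp {z : ℂ} (hz : z ≠ 0) (μ : ℂ) :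
    ‖z ^ μ‖ ≤ ‖z‖ ^ μ.re * Real.exp (Real.pi * |μ.im|) := by
  rw [Complex.norm_cpow_of_ne_zero hz, div_eq_mul_inv, ← Real.exp_neg]
  gcongr
  calc -(z.arg * μ.im) ≤ |z.arg * μ.im| := neg_le_abs _
    _ = |z.arg| * |μ.im| := abs_mul _ _
    _ ≤ _ := by gcongr; exact Complex.abs_arg_le_pi z

/-- The closed right half-plane without the origin lies in the slit plane. -/
lemma mem_slitPlane_of_re_nonneg {z : ℂ} (hz : 0 ≤ z.re) (hz0 : z ≠ 0) : z ∈ Complex.slitPlane := by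
  rw [Complex.mem_slitPlane_iff]
  by_contra! h
  exact hz0 (Complex.ext (le_antisymm h.1 hz) h.2)

lemma one_add_mul_rpow_neg_le {a ω t : ℝ} (ha : 0 ≤ a) (hω : 0 < ω) (ht : 0 < t) :
    1 + (ω * t) ^ (-a) ≤ (1 + ω ^ (-a)) * (t ^ (-a) * (1 + t) ^ ⌈a⌉₊) := by
  have h1 : 1 ≤ t ^ (-a) * (1 + t) ^ ⌈a⌉₊ := by
    rw [Real.rpow_neg ht.le, ← div_eq_inv_mul, one_le_div (by positivity)]
    calc t ^ a ≤ (1 + t) ^ a := by gcongr; linarith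
      _ ≤ (1 + t) ^ (⌈a⌉₊ : ℝ) :=
        Real.rpow_le_rpow_of_exponent_le (by linarith) (Nat.le_ceil a)
      _ = _ := Real.rpow_natCast _ _
  have h2 : t ^ (-a) ≤ t ^ (-a) * (1 + t) ^ ⌈a⌉₊ :=
    le_mul_of_one_le_right (by positivity) (one_le_pow₀ (by linarith))
  rw [Real.mul_rpow hω.le ht.le, add_mul, one_mul]
  gcongr

/-- The case of the exponential kernel. -/
lemma hasAbelIntegral_exp {f : ℂ → ℂ} (hf : AnalyticOnNhd ℂ f {z : ℂ | 0 < z.re})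
    (hfc : ContinuousOn f {z : ℂ | 0 ≤ z.re ∧ z ≠ 0}) {C : ℝ} {n : ℕ} (hC : 0 ≤ C)
    (hle : ∀ z : ℂ, 0 ≤ z.re → z ≠ 0 → ‖f z‖ ≤ C * (1 + ‖z‖) ^ n) {ω : ℝ} (hω : 0 < ω) {μ : ℂ}
    (hμ : -1 < μ.re) :
    ∃ L : ℂ,
      HasAbelIntegral (fun x : ℝ =>
        f (Complex.I * x) * (x : ℂ) ^ μ * Complex.exp (-(ω * x))) L ∧
      HasAbelIntegral (fun x : ℝ =>
        f x * (x : ℂ) ^ μ * Complex.exp (Complex.I * ω * x))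
        (Complex.exp ((μ + 1) * Real.pi * Complex.I / 2) * L) := by
  have hsl : ∀ z ∈ firstQuadrant, z ∈ Complex.slitPlane := fun z hz =>
    mem_slitPlane_of_re_nonneg hz.1 hz.2.2
  have hpow : ContinuousOn (fun z : ℂ => z ^ μ) firstQuadrant := fun z hz =>
    (continuousAt_cpow_const (hsl z hz)).continuousWithinAt
  have H := hasAbelIntegral_of_firstQuadrant
    (k := fun z => f z * z ^ μ * Complex.exp (Complex.I * ω * z))
    (((hfc.mono fun z hz => ⟨hz.1, hz.2.2⟩).mul hpow).mul (by fun_prop))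
    (fun z hz => ?_) (C := C * Real.exp (Real.pi * |μ.im|)) (b := -μ.re) (δ := ω) (n := n)
    (by positivity) (by linarith) hω (fun z hz => ?_)
  · obtain ⟨h1, h2⟩ := H
    have e : ∀ x ∈ Ioi (0 : ℝ), f (Complex.I * x) * (Complex.I * x) ^ μ *
        Complex.exp (Complex.I * ω * (Complex.I * x)) =
        Complex.exp (μ * Real.pi * Complex.I / 2) *
          (f (Complex.I * x) * (x : ℂ) ^ μ * Complex.exp (-(ω * x))) := by
      intro x hx
      rw [I_mul_ofReal_cpow hx, show Complex.I * ω * (Complex.I * x) =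
        (Complex.I * Complex.I) * (ω * x) by ring, Complex.I_mul_I]
      ring_nf
    have h3 : IntegrableOn (fun x : ℝ => f (Complex.I * x) * (x : ℂ) ^ μ *
        Complex.exp (-(ω * x))) (Ioi 0) := by
      refine IntegrableOn.congr_fun
        (h1.const_mul (Complex.exp (-(μ * Real.pi * Complex.I / 2)))) (fun x hx => ?_)
        measurableSet_Ioi
      simp only [e x hx]
      rw [← mul_assoc, ← Complex.exp_add, neg_add_cancel, Complex.exp_zero, one_mul]
    refine ⟨_, h3.hasAbelIntegral, ?_⟩
    rw [setIntegral_congr_fun measurableSet_Ioi e, integral_const_mul, ← mul_assoc] at h2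
    have e2 : Complex.exp ((μ + 1) * Real.pi * Complex.I / 2) =
        Complex.I * Complex.exp (μ * Real.pi * Complex.I / 2) := by
      rw [show (μ + 1) * Real.pi * Complex.I / 2 = Real.pi / 2 * Complex.I +
        μ * Real.pi * Complex.I / 2 by ring, Complex.exp_add, Complex.exp_pi_div_two_mul_I]
    rw [e2]
    exact h2
  · have hz' : z ∈ firstQuadrant := ⟨hz.1.le, hz.2.le, fun h => by simp [h] at hz⟩
    exact ((((hf z hz.1).differentiableAt).mul
      (differentiableAt_id.cpow_const (hsl z hz'))).mul (by fun_prop)).differentiableWithinAt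
  · have h3 : ‖Complex.exp (Complex.I * ω * z)‖ = Real.exp (-(ω * z.im)) := by
      rw [Complex.norm_exp]; simp [Complex.mul_re]
    rw [norm_mul, norm_mul, h3, neg_neg]
    calc _ ≤ C * (1 + ‖z‖) ^ n * (‖z‖ ^ μ.re * Real.exp (Real.pi * |μ.im|)) *
          Real.exp (-(ω * z.im)) := by
          gcongr
          · exact hle z hz.1 hz.2.2
          · exact norm_cpow_le_rpow_mul_exp hz.2.2 μ
      _ = _ := by ring

lemma exists_norm_mul_besselK_le {f : ℂ → ℂ} {C : ℝ} {n : ℕ} (hC : 0 ≤ C)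
    (hle : ∀ z : ℂ, 0 ≤ z.re → z ≠ 0 → ‖f z‖ ≤ C * (1 + ‖z‖) ^ n) {ω : ℝ} (hω : 0 < ω) (μ : ℂ)
    {ν : ℂ} {a : ℝ} (ha : |ν.re| < a) :
    ∃ (D δ : ℝ) (m : ℕ), 0 ≤ D ∧ 0 < δ ∧ ∀ z w : ℂ, 0 ≤ z.re → z ≠ 0 → 0 ≤ w.re →
      ‖w‖ = ω * ‖z‖ → ‖f z * z ^ μ * besselK ν w‖ ≤
        D * ‖z‖ ^ (-(a - μ.re)) * (1 + ‖z‖) ^ m * Real.exp (-(δ * w.re)) := by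
  have ha0 : 0 < a := (abs_nonneg _).trans_lt ha
  obtain ⟨B, δ, hB, hδ, hK⟩ := exists_norm_besselK_le ha
  refine ⟨C * Real.exp (Real.pi * |μ.im|) * B * (1 + ω ^ (-a)), δ, n + ⌈a⌉₊, by positivity, hδ,
    fun z w hz hz0 hw hwz => ?_⟩
  have hn : 0 < ‖z‖ := norm_pos_iff.2 hz0
  have hw0 : w ≠ 0 := norm_pos_iff.1 (by rw [hwz]; positivity)
  have h1 := hK w hw hw0
  rw [hwz] at h1
  rw [norm_mul, norm_mul]
  calc _ ≤ C * (1 + ‖z‖) ^ n * (‖z‖ ^ μ.re * Real.exp (Real.pi * |μ.im|)) *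
        (B * ((1 + ω ^ (-a)) * (‖z‖ ^ (-a) * (1 + ‖z‖) ^ ⌈a⌉₊)) * Real.exp (-(δ * w.re))) := by
        gcongr
        · exact hle z hz hz0
        · exact norm_cpow_le_rpow_mul_exp hz0 μ
        · refine h1.trans ?_
          gcongr
          exact one_add_mul_rpow_neg_le ha0.le hω hn
    _ = _ := by
        rw [show -(a - μ.re) = μ.re + -a by ring, Real.rpow_add hn, pow_add]
        ring

/-- The case of the Bessel kernels: `J_ν` is split by the connection formula into two parts, of
which one is moved to the positive and one to the negative imaginary axis. -/
lemma hasAbelIntegral_bessel {f : ℂ → ℂ} (hf : AnalyticOnNhd ℂ f {z : ℂ | 0 < z.re})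
    (hfc : ContinuousOn f {z : ℂ | 0 ≤ z.re ∧ z ≠ 0}) {C : ℝ} {n : ℕ} (hC : 0 ≤ C)
    (hle : ∀ z : ℂ, 0 ≤ z.re → z ≠ 0 → ‖f z‖ ≤ C * (1 + ‖z‖) ^ n) {ω : ℝ} (hω : 0 < ω) {μ ν : ℂ}
    (hadd : -1 < (μ + ν).re) (hsub : -1 < (μ - ν).re) :
    ∃ L : ℂ,
      HasAbelIntegral (fun x : ℝ =>
        rotHat μ ν f (Complex.I * x) * (x : ℂ) ^ μ * besselK ν (ω * x)) L ∧
      HasAbelIntegral (fun x : ℝ => f x * (x : ℂ) ^ μ * besselJ ν (ω * x)) L := by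
  have hω0 : (ω : ℂ) ≠ 0 := by exact_mod_cast hω.ne'
  have hpi : (Real.pi : ℂ) ≠ 0 := by exact_mod_cast Real.pi_ne_zero
  rw [Complex.add_re] at hadd
  rw [Complex.sub_re] at hsub
  obtain ⟨a, ha, ha1⟩ : ∃ a, |ν.re| < a ∧ a < 1 + μ.re :=
    exists_between (abs_lt.2 ⟨by linarith, by linarith⟩)
  obtain ⟨D, δ, m, hD, hδ, hbd⟩ := exists_norm_mul_besselK_le hC hle hω μ ha
  have hre1 : ∀ z : ℂ, (-(Complex.I * (ω * z))).re = ω * z.im := fun z => by simp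
  have hre2 : ∀ z : ℂ, (Complex.I * (ω * z)).re = -(ω * z.im) := fun z => by simp
  have hne1 : ∀ z : ℂ, z ≠ 0 → -(Complex.I * (ω * z)) ≠ 0 := fun z hz =>
    neg_ne_zero.2 (mul_ne_zero Complex.I_ne_zero (mul_ne_zero hω0 hz))
  have hne2 : ∀ z : ℂ, z ≠ 0 → Complex.I * (ω * z) ≠ 0 := fun z hz =>
    mul_ne_zero Complex.I_ne_zero (mul_ne_zero hω0 hz)
  have hd1 : ∀ z : ℂ, 0 ≤ z.im → z ≠ 0 →
      DifferentiableAt ℂ (fun z => besselK ν (-(Complex.I * (ω * z)))) z := fun z hz hz0 =>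
    (differentiableAt_besselK ν (by rw [hre1]; positivity) (hne1 z hz0)).comp
      (f := fun z : ℂ => -(Complex.I * (ω * z))) z (by fun_prop)
  have hd2 : ∀ z : ℂ, z.im ≤ 0 → z ≠ 0 →
      DifferentiableAt ℂ (fun z => besselK ν (Complex.I * (ω * z))) z := fun z hz hz0 =>
    (differentiableAt_besselK ν (by rw [hre2]; nlinarith) (hne2 z hz0)).comp
      (f := fun z : ℂ => Complex.I * (ω * z)) z (by fun_prop)
  have B1 := hasAbelIntegral_of_firstQuadrant
    (k := fun z => f z * z ^ μ * besselK ν (-(Complex.I * (ω * z)))) (fun z hz => ?_)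
    (fun z hz => ?_) (C := D) (b := a - μ.re) (δ := δ * ω) (n := m) hD (by linarith)
    (by positivity) (fun z hz => ?_)
  rotate_left
  · exact ((((hfc z ⟨hz.1, hz.2.2⟩).mono fun z hz => ⟨hz.1, hz.2.2⟩).mul
      (continuousAt_cpow_const (mem_slitPlane_of_re_nonneg hz.1 hz.2.2)).continuousWithinAt).mul
      (hd1 z hz.2.1 hz.2.2).continuousAt.continuousWithinAt)
  · have hz0 : z ≠ 0 := fun h => by simp [h] at hz
    exact ((((hf z hz.1).differentiableAt).mul (differentiableAt_id.cpow_const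
      (mem_slitPlane_of_re_nonneg hz.1.le hz0))).mul (hd1 z hz.2.le hz0)).differentiableWithinAt
  · have h := hbd z (-(Complex.I * (ω * z))) hz.1 hz.2.2
      (by rw [hre1]; have := hz.2.1; positivity) (by simp [abs_of_pos hω])
    rwa [hre1, ← mul_assoc δ] at h
  have B2 := hasAbelIntegral_of_fourthQuadrant
    (k := fun z => f z * z ^ μ * besselK ν (Complex.I * (ω * z))) (fun z hz => ?_)
    (fun z hz => ?_) (C := D) (b := a - μ.re) (δ := δ * ω) (n := m) hD (by linarith)
    (by positivity) (fun z hz hz' hz0 => ?_)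
  rotate_left
  · exact ((((hfc z ⟨hz.1, hz.2.2⟩).mono fun z hz => ⟨hz.1, hz.2.2⟩).mul
      (continuousAt_cpow_const (mem_slitPlane_of_re_nonneg hz.1 hz.2.2)).continuousWithinAt).mul
      (hd2 z hz.2.1 hz.2.2).continuousAt.continuousWithinAt)
  · have hz0 : z ≠ 0 := fun h => by simp [h] at hz
    exact ((((hf z hz.1).differentiableAt).mul (differentiableAt_id.cpow_const
      (mem_slitPlane_of_re_nonneg hz.1.le hz0))).mul (hd2 z hz.2.le hz0)).differentiableWithinAt
  · have h := hbd z (Complex.I * (ω * z)) hz hz0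
      (by rw [hre2]; nlinarith) (by simp [abs_of_pos hω])
    rwa [hre2, mul_neg, neg_neg, ← mul_assoc δ] at h
  obtain ⟨A1, H1⟩ := B1
  obtain ⟨A2, H2⟩ := B2
  have e1 : Complex.exp ((μ - ν) * Real.pi * Complex.I / 2) =
      Complex.exp (μ * Real.pi * Complex.I / 2) *
        Complex.exp (-(ν * Real.pi * Complex.I / 2)) := by
    rw [← Complex.exp_add]; ring_nf
  have e2 : Complex.exp ((ν - μ) * Real.pi * Complex.I / 2) =
      Complex.exp (-(μ * Real.pi * Complex.I / 2)) *
        Complex.exp (ν * Real.pi * Complex.I / 2) := by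
    rw [← Complex.exp_add]; ring_nf
  have e3 : ∀ x : ℝ, -(Complex.I * (ω * (Complex.I * x))) = ω * x := fun x => by
    linear_combination -(ω * x : ℂ) * Complex.I_mul_I
  have e4 : ∀ x : ℝ, Complex.I * (ω * -(Complex.I * x)) = ω * x := fun x => by
    linear_combination -(ω * x : ℂ) * Complex.I_mul_I
  simp only [e3, e4] at A1 A2 H1 H2
  have hint := (((A1.const_mul (Complex.exp (-(ν * Real.pi * Complex.I / 2)))).add
    (A2.const_mul (Complex.exp (ν * Real.pi * Complex.I / 2)))).const_mul (1 / (Real.pi : ℂ)))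
  refine ⟨_, (IntegrableOn.hasAbelIntegral hint).congr fun x hx => ?_, ?_⟩
  · simp only [Pi.add_apply]
    rw [rotHat, e1, e2, I_mul_ofReal_cpow hx, neg_I_mul_ofReal_cpow hx]
    ring
  · have hJ := ((H1.const_mul (Complex.exp (-(ν * Real.pi * Complex.I / 2)))).add
      (H2.const_mul (-Complex.exp (ν * Real.pi * Complex.I / 2)))).const_mul
        (1 / (Real.pi * Complex.I))
    have hL : ∀ P Q E F : ℂ, 1 / (Real.pi * Complex.I) * (E * (Complex.I * P) +
        -F * (-Complex.I * Q)) = 1 / Real.pi * (E * P + F * Q) := fun P Q E F => by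
      field_simp
    rw [hL] at hJ
    simp only [Pi.add_apply]
    rw [integral_const_mul, integral_add (A1.const_mul _) (A2.const_mul _), integral_const_mul,
      integral_const_mul]
    refine hJ.congr fun x hx => ?_
    have hc := pi_mul_I_mul_besselJ ν (mul_pos hω hx)
    push_cast at hc
    have hJ' : besselJ ν (ω * x) = 1 / (Real.pi * Complex.I) *
        (Complex.exp (-(ν * Real.pi * Complex.I / 2)) * besselK ν (-(Complex.I * (ω * x))) -
        Complex.exp (ν * Real.pi * Complex.I / 2) * besselK ν (Complex.I * (ω * x))) := by
      rw [← hc]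
      field_simp
    rw [hJ']
    ring

/-! ### The rotation identities -/

theorem mainTheorem1 (f : ℂ → ℂ)
    -- `f` is analytic in the open right half-plane, with continuous values on its boundary
    -- (away from `0`)
    (hf : AnalyticOnNhd ℂ f {z : ℂ | 0 < z.re})
    (hfc : ContinuousOn f {z : ℂ | 0 ≤ z.re ∧ z ≠ 0})
    -- polynomial growth at infinity
    (hinf : ∃ K σ : ℝ, ∀ᶠ z in Bornology.cobounded ℂ ⊓ 𝓟 {z : ℂ | 0 < z.re},
      ‖f z‖ ≤ K * ‖z‖ ^ σ)
    -- boundedness near `0`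
    (hzero : ∃ M : ℝ, ∀ᶠ z in 𝓝[{z : ℂ | 0 < z.re}] 0, ‖f z‖ ≤ M)
    (ω : ℝ) (hω : 0 < ω) :
    (∀ μ : ℂ, -1 < μ.re →
      ∃ L : ℂ,
        HasAbelIntegral (fun x : ℝ =>
          f (Complex.I * x) * (x : ℂ) ^ μ * Complex.exp (-(ω * x))) L ∧
        HasAbelIntegral (fun x : ℝ =>
          f x * (x : ℂ) ^ μ * Complex.exp (Complex.I * ω * x))
          (Complex.exp ((μ + 1) * Real.pi * Complex.I / 2) * L)) ∧
    (∀ μ ν : ℂ, -1 < (μ + ν).re → -1 < (μ - ν).re →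
      ∃ L : ℂ,
        HasAbelIntegral (fun x : ℝ =>
          rotHat μ ν f (Complex.I * x) * (x : ℂ) ^ μ * besselK ν (ω * x)) L ∧
        HasAbelIntegral (fun x : ℝ =>
          f x * (x : ℂ) ^ μ * besselJ ν (ω * x)) L) := by
  obtain ⟨C, n, hC, hle⟩ := exists_norm_le_one_add_pow hfc hinf hzero
  exact ⟨fun μ hμ => hasAbelIntegral_exp hf hfc hC hle hω hμ,
    fun μ ν hadd hsub => hasAbelIntegral_bessel hf hfc hC hle hω hadd hsub⟩
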